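/- Let $K$ be a field. For an additive $K$-category $\mathcal C$, a $\mathcal C$-module is an additive functor $\mathcal C\to\mathbf{Ab}$. A filtration of $\mathcal C$ is a chain $0=\mathcal C_0\subseteq\mathcal C_1\subseteq\cdots$ of full subcategories, each closed under isomorphisms, finite direct sums and direct summands, with $\bigcup_j\mathcal C_j=\mathcal C$. Let $I_{\mathcal C_j}$ be the ideal of morphisms that factor through an object of $\mathcal C_j$. A two-sided ideal $I$ is heredity if $I^2=I$, $I\cdot\mathrm{rad}\cdot I=0$ and every module $I(X,-)$ is finitely generated projective; $\mathcal C$ is quasi-hereditary with respect to $\{\mathcal C_j\}$ if $I_{\mathcal C_j}/I_{\mathcal C_{j-1}}$ is a heredity ideal of $\mathcal C/I_{\mathcal C_{j-1}}$ for all $j\ge 1$. For $j\ge1$ the class ${}_{\mathcal C}\Delta(j)$ consists of the standard modules $\mathcal C(E,-)/I_{\mathcal C_{j-1}}(E,-)$ with $E$ indecomposable in $\mathcal C_j$ and not in $\mathcal C_{j-1}$, and ${}_{\mathcal C}\Delta=\bigcup_{j\ge1}{}_{\mathcal C}\Delta(j)$. A module $F$ is $\Delta$-filtered if it has a chain of submodules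 $0=F_0\subseteq F_1\subseteq\cdots$ with $\bigcup_jF_j=F$ such that every $F_{j+1}/F_j$ is a finite direct sum of modules in ${}_{\mathcal C}\Delta$; it is finitely $\Delta$-filtered if such a chain exists with $F_m=F$ for some $m$. The trace filtration of $F$ is $\{F^{[j]}\}_{j\ge0}$, where $F^{[j]}$ is the sum of the images of all morphisms $\mathcal C(E,-)\to F$ with $E\in\mathcal C_j$; $F$ is trace-$\Delta$-filtered if $F^{[j]}/F^{[j-1]}$ is a finite direct sum of modules in ${}_{\mathcal C}\Delta(j)$ for all $j\ge1$. Let $\mathcal T$ and $\mathcal U$ be Hom-finite Krull–Schmidt $K$-categories that are quasi-hereditary with respect to filtrations $\{\mathcal T_j\}_{j\ge0}$ and $\{\mathcal U_j\}_{0\le j\le n}$ (so $\mathcal U_n=\mathcal U$). Let $M:\mathcal U\otimes_K\mathcal T^{op}\to\mathrm{mod}\,K$ be a $K$-linear functor such that the $\mathcal U$-module $M_T=M(-,T)$ is $\Delta$-filtered for every $T\in\mathcal T$. Let $\Lambda=\left(\begin{smallmatrix}\mathcal T&0\\ M&\mathcal U\end{smallmatrix}\right)$ be the triangular matrix category: its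 objects are pairs $(T,U)$; its morphisms $(T,U)\to(T',U')$ are the matrices $\left(\begin{smallmatrix}f&0\\ m&g\end{smallmatrix}\right)$ with $f\in\mathcal T(T,T')$, $m\in M(U',T)$, $g\in\mathcal U(U,U')$; composition is matrix multiplication. Give it the filtration $\Lambda_j=\{(0,U):U\in\mathcal U_j\}$ for $0\le j\le n$, and $\Lambda_{n+j}=\{(T,U):T\in\mathcal T_j,\ U\in\mathcal U\}$ for $j\ge1$. Consider triples $(F^{(1)},f,F^{(2)})$ consisting of a $\mathcal T$-module $F^{(1)}$, a $\mathcal U$-module $F^{(2)}$ and a natural transformation $f:F^{(1)}\to\mathrm{Hom}_{\mathcal U}(M_{(-)},F^{(2)})$. Such a triple defines the $\Lambda$-module $(T,U)\mapsto F^{(1)}(T)\oplus F^{(2)}(U)$, on which $\left(\begin{smallmatrix}\varphi&0\\ m&g\end{smallmatrix}\right)$ acts by $(x,y)\mapsto(F^{(1)}(\varphi)(x),\,f(x)(m)+F^{(2)}(g)(y))$. Conversely, a $\Lambda$-module $F$ defines the triple with $F^{(1)}(T)=F(T,0)$, $F^{(2)}(U)=F(0,U)$ and $f(x)(m)=F\left(\begin{smallmatrix}0&0\\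 m&0\end{smallmatrix}\right)(x)$. Every $\Lambda$-module is isomorphic to the module of its triple. Let $F$ be a $\Lambda$-module isomorphic to the module of the triple $(F^{(1)},f,F^{(2)})$, and let $\{F^{[j]}\}_{j\ge0}$ be its trace filtration with respect to $\{\Lambda_j\}$. Then: (i) $(F^{[j]})^{(1)}\cong0$ if $0\le j\le n$, and, if $j>n$, the inclusion $F^{[j]}\subseteq F$ induces an isomorphism on $\mathcal U$-components, so that $(F^{[j]})^{(2)}\cong F^{(2)}$. (ii) If $F$ is $\Delta$-filtered over $\Lambda$, then $F^{(1)}$ is $\Delta$-filtered over $\mathcal T$ and $F^{(2)}$ is $\Delta$-filtered over $\mathcal U$. Likewise, if $F$ is trace-$\Delta$-filtered, then so are $F^{(1)}$ and $F^{(2)}$. (iii) $F$ is finitely $\Delta$-filtered over $\Lambda$ if and only if $F^{(1)}$ is finitely $\Delta$-filtered over $\mathcal T$ and $F^{(2)}$ is finitely $\Delta$-filtered over $\mathcal U$. -/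

import Mathlib

open CategoryTheory CategoryTheory.Limits Opposite

universe v u u₁ u₂ w

noncomputable section

namespace TriQH

open ZeroObject

attribute [local instance] CategoryTheory.Limits.hasBinaryBiproducts_of_finite_biproducts

/-! ### Modules over an additive category, submodules and quotients

A `C`-module is an additive functor `F : C ⥤ AddCommGrpCat`. -/

section Modules

variable {C : Type u} [Category.{v} C] [Preadditive C]

/-- The representable module `C(E, -)`. -/
def rep (E : C) : C ⥤ AddCommGrpCat.{v} where
  obj Y := AddCommGrpCat.of (E ⟶ Y)
  map f := AddCommGrpCat.ofHom
    { toFun := fun g => g ≫ f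
      map_zero' := zero_comp
      map_add' := fun _ _ => Preadditive.add_comp _ _ _ _ _ _ }
  map_id _ := by ext g; exact Category.comp_id g
  map_comp _ _ := by ext g; exact (Category.assoc g _ _).symm

instance (E : C) : (rep E).Additive where
  map_add := by intro X Y f g; ext h; exact Preadditive.comp_add _ _ _ _ _ _

/-- A submodule of a `C`-module. -/
@[ext]
structure Submod (F : C ⥤ AddCommGrpCat.{v}) where
  carrier : ∀ X : C, AddSubgroup (F.obj X)
  map_mem : ∀ {X Y : C} (f : X ⟶ Y) (x : F.obj X), x ∈ carrier X → (F.map f).hom x ∈ carrier Y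

namespace Submod

variable {F : C ⥤ AddCommGrpCat.{v}}

/-- A submodule, regarded as a module. -/
def toFunctor (N : Submod F) : C ⥤ AddCommGrpCat.{v} where
  obj X := AddCommGrpCat.of (N.carrier X)
  map {X Y} f := AddCommGrpCat.ofHom
    (((F.map f).hom.comp (N.carrier X).subtype).codRestrict (N.carrier Y)
      (fun x => N.map_mem f x.1 x.2))
  map_id X := by ext x; change (F.map (𝟙 X)).hom x.1 = x.1; simp
  map_comp f g := by
    ext x
    change (F.map (f ≫ g)).hom x.1 = (F.map g).hom ((F.map f).hom x.1); simp

instance (N : Submod F) [F.Additive] : N.toFunctor.Additive where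
  map_add := by
    intro X Y f g; ext x; apply Subtype.ext
    change (F.map (f + g)).hom x.1 = (F.map f).hom x.1 + (F.map g).hom x.1
    rw [F.map_add]; rfl

/-- The inclusion of a submodule. -/
def ι (N : Submod F) : N.toFunctor ⟶ F where
  app X := AddCommGrpCat.ofHom (N.carrier X).subtype
  naturality _ _ _ := by ext x; rfl

/-- The quotient module `F / N`. -/
def quot (N : Submod F) : C ⥤ AddCommGrpCat.{v} where
  obj X := AddCommGrpCat.of (F.obj X ⧸ N.carrier X)
  map {X Y} f := AddCommGrpCat.ofHom
    (QuotientAddGroup.map (N.carrier X) (N.carrier Y) (F.map f).hom (fun x hx => N.map_mem f x hx))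
  map_id X := by
    ext x
    change QuotientAddGroup.mk ((F.map (𝟙 X)).hom x) = QuotientAddGroup.mk x
    simp
  map_comp f g := by
    ext x
    change QuotientAddGroup.mk ((F.map (f ≫ g)).hom x) =
      QuotientAddGroup.mk ((F.map g).hom ((F.map f).hom x))
    simp

/-- For submodules `L ⊆ N` of `F`, the quotient module `N / L`. -/
def subquot (L N : Submod F) : C ⥤ AddCommGrpCat.{v} :=
  Submod.quot (F := N.toFunctor)
    { carrier := fun X => (L.carrier X).addSubgroupOf (N.carrier X)
      map_mem := fun f x hx => L.map_mem f x.1 hx }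

end Submod

/-- The trace of the family `{C(E, -) : P E}` in `F`: the sum of the images of all morphisms
`C(E, -) ⟶ F` with `P E`. -/
def trace (P : ObjectProperty C) (F : C ⥤ AddCommGrpCat.{v}) : Submod F where
  carrier X := ⨆ (E : C) (_ : P E) (η : rep E ⟶ F), (η.app X).hom.range
  map_mem {X Y} f x hx := by
    have key : (⨆ (E : C) (_ : P E) (η : rep E ⟶ F), (η.app X).hom.range) ≤
        (⨆ (E : C) (_ : P E) (η : rep E ⟶ F), (η.app Y).hom.range).comap (F.map f).hom := by
      refine iSup_le fun E => iSup_le fun hE => iSup_le fun η => ?_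
      rintro _ ⟨g, rfl⟩
      refine AddSubgroup.mem_iSup_of_mem E (AddSubgroup.mem_iSup_of_mem hE
        (AddSubgroup.mem_iSup_of_mem η ⟨((rep E).map f).hom g, ?_⟩))
      exact congrArg (fun φ => φ.hom g) (η.naturality f)
    exact key hx

/-- `F` is finitely generated: finitely many elements generate it (equivalently, it is a quotient
of a finite direct sum of representable modules). -/
def FinGen (F : C ⥤ AddCommGrpCat.{v}) : Prop :=
  ∃ (m : ℕ) (E : Fin m → C) (x : ∀ i, F.obj (E i)),
    ∀ (Y : C) (y : F.obj Y), ∃ g : ∀ i, E i ⟶ Y, y = ∑ i, (F.map (g i)).hom (x i)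

instance : HasFiniteBiproducts (C ⥤ AddCommGrpCat.{v}) :=
  HasFiniteBiproducts.of_hasFiniteProducts

/-- `𝒳^⨿`: the modules that are finite direct sums of modules in the class `𝒳`. -/
def FinSum (𝒳 : (C ⥤ AddCommGrpCat.{v}) → Prop) (F : C ⥤ AddCommGrpCat.{v}) : Prop :=
  ∃ (m : ℕ) (S : Fin m → (C ⥤ AddCommGrpCat.{v})), (∀ i, 𝒳 (S i)) ∧ Nonempty (F ≅ ⨁ S)

/-- An ascending chain of submodules of `F`, starting at `0`, whose successive quotients are
finite direct sums of modules in `𝒳`. -/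
structure IsChain (𝒳 : (C ⥤ AddCommGrpCat.{v}) → Prop) {F : C ⥤ AddCommGrpCat.{v}}
    (c : ℕ → Submod F) : Prop where
  mono : ∀ j X, (c j).carrier X ≤ (c (j + 1)).carrier X
  zero : ∀ X, (c 0).carrier X = ⊥
  step : ∀ j, FinSum 𝒳 (Submod.subquot (c j) (c (j + 1)))

/-- `F` is `𝒳`-filtered. -/
def Filtered (𝒳 : (C ⥤ AddCommGrpCat.{v}) → Prop) (F : C ⥤ AddCommGrpCat.{v}) : Prop :=
  ∃ c : ℕ → Submod F, IsChain 𝒳 c ∧ ∀ (X : C) (x : F.obj X), ∃ j, x ∈ (c j).carrier X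

/-- `F` is finitely `𝒳`-filtered. -/
def FinFiltered (𝒳 : (C ⥤ AddCommGrpCat.{v}) → Prop) (F : C ⥤ AddCommGrpCat.{v}) : Prop :=
  ∃ c : ℕ → Submod F, IsChain 𝒳 c ∧ ∃ m, ∀ X, (c m).carrier X = ⊤

end Modules

/-! ### Two-sided ideals, quotient categories, heredity ideals -/

section Ideals

variable (K : Type w) [Field K] (C : Type u) [Category.{v} C] [Preadditive C] [Linear K C]

/-- A two-sided ideal of a `K`-category. -/
structure CatIdeal where
  carrier : ∀ X Y : C, Submodule K (X ⟶ Y)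
  mem_comp : ∀ {X Y Z : C} (f : X ⟶ Y) (g : Y ⟶ Z), f ∈ carrier X Y → f ≫ g ∈ carrier X Z
  comp_mem : ∀ {X Y Z : C} (f : X ⟶ Y) (g : Y ⟶ Z), g ∈ carrier Y Z → f ≫ g ∈ carrier X Z

variable {K C}

namespace CatIdeal

/-- `f ∼ g` if and only if `f - g` lies in the ideal. -/
def rel (I : CatIdeal K C) : HomRel C := fun X Y f g => f - g ∈ I.carrier X Y

instance (I : CatIdeal K C) : Congruence I.rel where
  equivalence :=
    { refl := fun f => by simp [rel]
      symm := fun {f g} h => by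
        have := (I.carrier _ _).neg_mem h
        rwa [neg_sub] at this
      trans := fun {f g h} h₁ h₂ => by
        have := (I.carrier _ _).add_mem h₁ h₂
        rwa [sub_add_sub_cancel] at this }
  comp_left f g g' h := by
    have := I.comp_mem f _ h
    rwa [Preadditive.comp_sub] at this
  comp_right g h := by
    have := I.mem_comp _ g h
    rwa [Preadditive.sub_comp] at this

/-- The quotient category `C / I`. -/
abbrev Quot (I : CatIdeal K C) := CategoryTheory.Quotient I.rel

theorem rel_add (I : CatIdeal K C) ⦃X Y : C⦄ (f₁ f₂ g₁ g₂ : X ⟶ Y) (h : I.rel f₁ f₂)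
    (h' : I.rel g₁ g₂) : I.rel (f₁ + g₁) (f₂ + g₂) := by
  have := (I.carrier _ _).add_mem h h'
  change f₁ + g₁ - (f₂ + g₂) ∈ _
  rwa [add_sub_add_comm]

theorem rel_smul (I : CatIdeal K C) (a : K) ⦃X Y : C⦄ (f₁ f₂ : X ⟶ Y) (h : I.rel f₁ f₂) :
    I.rel (a • f₁) (a • f₂) := by
  have := (I.carrier _ _).smul_mem a h
  rwa [smul_sub] at this

instance (I : CatIdeal K C) : Preadditive I.Quot := Quotient.preadditive I.rel I.rel_add

instance (I : CatIdeal K C) : (Quotient.functor I.rel).Additive :=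
  Quotient.functor_additive I.rel I.rel_add

instance (I : CatIdeal K C) : Linear K I.Quot := Quotient.linear K I.rel I.rel_smul

instance (I : CatIdeal K C) : (Quotient.functor I.rel).Linear K :=
  Quotient.linear_functor K I.rel I.rel_smul

/-- The image `(I + J) / J` of an ideal `I` in the quotient category `C / J`. -/
def quotient (I J : CatIdeal K C) : CatIdeal K J.Quot where
  carrier X Y := (I.carrier X.as Y.as).map ((Quotient.functor J.rel).mapLinearMap K)
  mem_comp {X Y Z} f g hf := by
    obtain ⟨f, hf, rfl⟩ := hf
    obtain ⟨g, rfl⟩ := (Quotient.functor J.rel).map_surjective (X := Y.as) (Y := Z.as) g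
    exact ⟨f ≫ g, I.mem_comp f g hf, (Quotient.functor J.rel).map_comp f g⟩
  comp_mem {X Y Z} f g hg := by
    obtain ⟨g, hg, rfl⟩ := hg
    obtain ⟨f, rfl⟩ := (Quotient.functor J.rel).map_surjective (X := X.as) (Y := Y.as) f
    exact ⟨f ≫ g, I.comp_mem f g hg, (Quotient.functor J.rel).map_comp f g⟩

/-- The submodule `I(X, -)` of the representable module `C(X, -)`. -/
def sub (I : CatIdeal K C) (X : C) : Submod (rep X) where
  carrier Y := (I.carrier X Y).toAddSubgroup
  map_mem f g hg := I.mem_comp g f hg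

end CatIdeal

/-- Membership in the Jacobson radical of a preadditive category. -/
def InRad {C : Type u} [Category.{v} C] [Preadditive C] {X Y : C} (h : X ⟶ Y) : Prop :=
  ∀ g : Y ⟶ X, IsIso (𝟙 X - h ≫ g)

/-- (Left) heredity ideals: `I² = I`, `I · rad · I = 0`, and all the modules `I(X, -)` are
finitely generated and projective in the category of modules (additive functors). -/
structure CatIdeal.IsHeredity (I : CatIdeal K C) : Prop where
  idem : ∀ X Y : C, Submodule.span K
    {h : X ⟶ Y | ∃ (Z : C) (f : X ⟶ Z) (g : Z ⟶ Y),
      f ∈ I.carrier X Z ∧ g ∈ I.carrier Z Y ∧ f ≫ g = h} = I.carrier X Y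
  rad : ∀ {W X Y Z : C} (f : W ⟶ X) (r : X ⟶ Y) (g : Y ⟶ Z),
    f ∈ I.carrier W X → InRad r → g ∈ I.carrier Y Z → f ≫ r ≫ g = 0
  finGen : ∀ X : C, FinGen (I.sub X).toFunctor
  proj : ∀ X : C, Projective (AdditiveFunctor.of (I.sub X).toFunctor)

end Ideals

/-! ### Krull-Schmidt and quasi-hereditary categories, standard modules -/

section QuasiHereditary

/-- `Hom`-finiteness over `K`. -/
def HomFinite (K : Type w) [Field K] (C : Type u) [Category.{v} C] [Preadditive C]
    [Linear K C] : Prop :=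
  ∀ X Y : C, Module.Finite K (X ⟶ Y)

/-- Every object is a finite direct sum of objects with local endomorphism rings (which are
then indecomposable). -/
def KrullSchmidt (C : Type u) [Category.{v} C] [Preadditive C] [HasFiniteBiproducts C] : Prop :=
  ∀ X : C, ∃ (m : ℕ) (S : Fin m → C), (∀ i, IsLocalRing (End (S i))) ∧ Nonempty (X ≅ ⨁ S)

/-- An exhaustive ascending filtration `0 = C₀ ⊆ C₁ ⊆ C₂ ⊆ ⋯` of `C` by additively closed full
subcategories (closed under isomorphisms, finite direct sums and direct summands). -/
structure AddFiltration (C : Type u) [Category.{v} C] [Preadditive C]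
    [HasFiniteBiproducts C] where
  level : ℕ → ObjectProperty C
  mono : ∀ j X, level j X → level (j + 1) X
  exhaustive : ∀ X, ∃ j, level j X
  zero_iff : ∀ X, level 0 X ↔ IsZero X
  of_iso : ∀ j X Y, (X ≅ Y) → level j X → level j Y
  biprod : ∀ j X Y, level j X → level j Y → level j (X ⊞ Y)
  summand : ∀ j X Y, level j (X ⊞ Y) → level j X

variable {C : Type u} [Category.{v} C] [Preadditive C] [HasFiniteBiproducts C]

theorem AddFiltration.zero_mem (𝒞 : AddFiltration C) (j : ℕ) : 𝒞.level j (0 : C) := by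
  induction j with
  | zero => exact (𝒞.zero_iff _).2 (isZero_zero C)
  | succ j ih => exact 𝒞.mono j _ ih

variable (K : Type w) [Field K] [Linear K C]

/-- The ideal of all morphisms that factor through an object of the `j`-th subcategory. -/
def AddFiltration.ideal (𝒞 : AddFiltration C) (j : ℕ) : CatIdeal K C where
  carrier X Y :=
    { carrier := {f | ∃ (E : C) (a : X ⟶ E) (b : E ⟶ Y), 𝒞.level j E ∧ a ≫ b = f}
      zero_mem' := ⟨0, 0, 0, 𝒞.zero_mem j, by simp⟩
      add_mem' := by
        rintro _ _ ⟨E, a, b, hE, rfl⟩ ⟨E', a', b', hE', rfl⟩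
        exact ⟨E ⊞ E', biprod.lift a a', biprod.desc b b', 𝒞.biprod j _ _ hE hE', by simp⟩
      smul_mem' := by
        rintro c _ ⟨E, a, b, hE, rfl⟩
        exact ⟨E, a, c • b, hE, by simp⟩ }
  mem_comp := by
    rintro X Y Z _ g ⟨E, a, b, hE, rfl⟩
    exact ⟨E, a, b ≫ g, hE, by simp⟩
  comp_mem := by
    rintro X Y Z f _ ⟨E, a, b, hE, rfl⟩
    exact ⟨E, f ≫ a, b, hE, by simp⟩

/-- `C` is quasi-hereditary with respect to the filtration: with `I j` the ideal of the `j`-th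
subcategory, `I (j + 1) / I j` is a heredity ideal of `C / I j` for all `j`. -/
def QuasiHereditary (𝒞 : AddFiltration C) : Prop :=
  ∀ j, ((𝒞.ideal K (j + 1)).quotient (𝒞.ideal K j)).IsHeredity

/-- The modules `Δ_E(j + 1) = C(E, -) / I j (E, -)`, with `E` an indecomposable object of the
`(j + 1)`-st subcategory that does not lie in the `j`-th one, up to isomorphism. -/
def StandardAt (𝒞 : AddFiltration C) (j : ℕ) (S : C ⥤ AddCommGrpCat.{v}) : Prop :=
  ∃ E : C, Indecomposable E ∧ 𝒞.level (j + 1) E ∧ ¬ 𝒞.level j E ∧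
    Nonempty (S ≅ ((𝒞.ideal K j).sub E).quot)

/-- The class of standard modules. -/
def Standard (𝒞 : AddFiltration C) (S : C ⥤ AddCommGrpCat.{v}) : Prop :=
  ∃ j, StandardAt K 𝒞 j S

/-- The `j`-th term `F^[j]` of the trace filtration of `F`. -/
def traceAt (𝒞 : AddFiltration C) (F : C ⥤ AddCommGrpCat.{v}) (j : ℕ) : Submod F :=
  trace (𝒞.level j) F

/-- The successive quotients `F^[j + 1] / F^[j]` of the trace filtration are finite direct sums of
standard modules of level `j + 1`. -/
def TraceFiltered (𝒞 : AddFiltration C) (F : C ⥤ AddCommGrpCat.{v}) : Prop :=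
  ∀ j, FinSum (StandardAt K 𝒞 j) (Submod.subquot (traceAt 𝒞 F j) (traceAt 𝒞 F (j + 1)))

end QuasiHereditary

/-! ### Triangular matrix categories -/

section Triangular

variable (K : Type w) [Field K]
  (T : Type u₁) [Category.{v} T] [Preadditive T] [Linear K T]
  (U : Type u₂) [Category.{v} U] [Preadditive U] [Linear K U]

/-- A `K`-linear functor `U ⊗ Tᵒᵖ ⥤ Mod K`, that is, a functor of two variables which is
`K`-linear in each of them. -/
structure Bimod where
  functor : Tᵒᵖ ⥤ U ⥤ ModuleCat.{v} K
  additive : ∀ t, (functor.obj t).Additive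
  linear : ∀ t, (functor.obj t).Linear K
  map_add : ∀ {t t' : T} (f g : t ⟶ t'),
    functor.map (f + g).op = functor.map f.op + functor.map g.op
  map_smul : ∀ {t t' : T} (a : K) (f : t ⟶ t'), functor.map (a • f).op = a • functor.map f.op

variable {K T U}

namespace Bimod

variable (M : Bimod K T U)

instance (t : Tᵒᵖ) : (M.functor.obj t).Additive := M.additive t
instance (t : Tᵒᵖ) : (M.functor.obj t).Linear K := M.linear t

/-- The vector space `M(u, t)`. -/
abbrev val (t : T) (u : U) : ModuleCat.{v} K := (M.functor.obj (op t)).obj u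

/-- `g • m = M(g ⊗ 1)(m)`. -/
def left {t : T} {u u' : U} (g : u ⟶ u') : M.val t u →ₗ[K] M.val t u' :=
  ((M.functor.obj (op t)).map g).hom

/-- `m • f = M(1 ⊗ fᵒᵖ)(m)`. -/
def right {t t' : T} {u : U} (f : t ⟶ t') : M.val t' u →ₗ[K] M.val t u :=
  ((M.functor.map f.op).app u).hom

/-- The `U`-module `M_t = M(-, t)`. -/
def col (t : T) : U ⥤ AddCommGrpCat.{v} :=
  M.functor.obj (op t) ⋙ forget₂ (ModuleCat.{v} K) AddCommGrpCat.{v}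

instance (t : T) : (M.col t).Additive := by unfold col; infer_instance

/-- The morphism of `U`-modules `M_{t'} ⟶ M_t` induced by `f : t ⟶ t'`. -/
def colMap {t t' : T} (f : t ⟶ t') : M.col t' ⟶ M.col t :=
  Functor.whiskerRight (M.functor.map f.op) (forget₂ (ModuleCat.{v} K) AddCommGrpCat.{v})

variable {M}

@[simp] theorem left_id {t : T} {u : U} (m : M.val t u) : M.left (𝟙 u) m = m := by simp [left]

@[simp] theorem left_comp {t : T} {u u' u'' : U} (g : u ⟶ u') (g' : u' ⟶ u'') (m : M.val t u) :
    M.left (g ≫ g') m = M.left g' (M.left g m) := by simp [left]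

@[simp] theorem right_id {t : T} {u : U} (m : M.val t u) : M.right (𝟙 t) m = m := by simp [right]

@[simp] theorem right_comp {t t' t'' : T} {u : U} (f : t ⟶ t') (f' : t' ⟶ t'')
    (m : M.val t'' u) : M.right (f ≫ f') m = M.right f (M.right f' m) := by simp [right]

theorem right_left {t t' : T} {u u' : U} (f : t ⟶ t') (g : u ⟶ u') (m : M.val t' u) :
    M.right f (M.left g m) = M.left g (M.right f m) := by
  have := congrArg (fun φ => φ.hom m) ((M.functor.map f.op).naturality g)
  simpa [left, right] using this

@[simp] theorem left_add {t : T} {u u' : U} (g g' : u ⟶ u') (m : M.val t u) :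
    M.left (g + g') m = M.left g m + M.left g' m := by
  simp [left, (M.functor.obj (op t)).map_add]

@[simp] theorem left_smul {t : T} {u u' : U} (a : K) (g : u ⟶ u') (m : M.val t u) :
    M.left (a • g) m = a • M.left g m := by
  simp [left, (M.functor.obj (op t)).map_smul]

@[simp] theorem right_add {t t' : T} {u : U} (f f' : t ⟶ t') (m : M.val t' u) :
    M.right (f + f') m = M.right f m + M.right f' m := by
  unfold right; rw [M.map_add]; simp

@[simp] theorem right_smul {t t' : T} {u : U} (a : K) (f : t ⟶ t') (m : M.val t' u) :
    M.right (a • f) m = a • M.right f m := by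
  unfold right; rw [M.map_smul]; simp

@[simp] theorem left_zero {t : T} {u u' : U} (m : M.val t u) :
    M.left (0 : u ⟶ u') m = 0 := by simp [left]

@[simp] theorem right_zero {t t' : T} {u : U} (m : M.val t' u) :
    M.right (0 : t ⟶ t') m = 0 := by
  simpa using right_smul (M := M) (0 : K) (0 : t ⟶ t') m

end Bimod

/-- The triangular matrix category `Λ = (T 0; M U)`: its objects are pairs of an object of `T` and
an object of `U`. -/
structure Tri (M : Bimod K T U) where
  fst : T
  snd : U

namespace Tri

variable {M : Bimod K T U}

/-- A morphism `(f 0; m g)` is given by `f : T ⟶ T'`, `m ∈ M(U', T)` and `g : U ⟶ U'`. -/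
@[ext]
structure Hom (X Y : Tri M) : Type v where
  f : X.fst ⟶ Y.fst
  m : M.val X.fst Y.snd
  g : X.snd ⟶ Y.snd

/-- Composition: `(f₂ 0; m₂ g₂) ∘ (f₁ 0; m₁ g₁) = (f₂f₁ 0; m₂•f₁ + g₂•m₁ g₂g₁)`. -/
instance : Category.{v} (Tri M) where
  Hom := Hom
  id X := ⟨𝟙 _, 0, 𝟙 _⟩
  comp a b := ⟨a.f ≫ b.f, M.right a.f b.m + M.left b.g a.m, a.g ≫ b.g⟩
  id_comp a := by ext <;> simp
  comp_id a := by ext <;> simp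
  assoc a b c := by
    ext
    · simp
    · simp [Bimod.right_left, add_assoc]
    · simp

@[ext] theorem hom_ext {X Y : Tri M} {a b : X ⟶ Y} (hf : a.f = b.f) (hm : a.m = b.m)
    (hg : a.g = b.g) : a = b := Hom.ext hf hm hg

@[simp] theorem id_f (X : Tri M) : Hom.f (𝟙 X) = 𝟙 X.fst := rfl
@[simp] theorem id_m (X : Tri M) : Hom.m (𝟙 X) = 0 := rfl
@[simp] theorem id_g (X : Tri M) : Hom.g (𝟙 X) = 𝟙 X.snd := rfl
@[simp] theorem comp_f {X Y Z : Tri M} (a : X ⟶ Y) (b : Y ⟶ Z) : (a ≫ b).f = a.f ≫ b.f := rfl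
@[simp] theorem comp_m {X Y Z : Tri M} (a : X ⟶ Y) (b : Y ⟶ Z) :
    (a ≫ b).m = M.right a.f b.m + M.left b.g a.m := rfl
@[simp] theorem comp_g {X Y Z : Tri M} (a : X ⟶ Y) (b : Y ⟶ Z) : (a ≫ b).g = a.g ≫ b.g := rfl

/-- A morphism of `Λ` as a triple. -/
def homEquiv (X Y : Tri M) :
    (X ⟶ Y) ≃ (X.fst ⟶ Y.fst) × M.val X.fst Y.snd × (X.snd ⟶ Y.snd) where
  toFun a := (a.f, a.m, a.g)
  invFun p := ⟨p.1, p.2.1, p.2.2⟩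
  left_inv _ := rfl
  right_inv _ := rfl

/-- Addition and scalar multiplication of morphisms are entrywise. -/
instance (X Y : Tri M) : AddCommGroup (X ⟶ Y) := (homEquiv X Y).addCommGroup

instance (X Y : Tri M) : Module K (X ⟶ Y) := (homEquiv X Y).module K

@[simp] theorem add_f {X Y : Tri M} (a b : X ⟶ Y) : (a + b).f = a.f + b.f := rfl
@[simp] theorem add_m {X Y : Tri M} (a b : X ⟶ Y) : (a + b).m = a.m + b.m := rfl
@[simp] theorem add_g {X Y : Tri M} (a b : X ⟶ Y) : (a + b).g = a.g + b.g := rfl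
@[simp] theorem zero_f (X Y : Tri M) : Hom.f (0 : X ⟶ Y) = 0 := rfl
@[simp] theorem zero_m (X Y : Tri M) : Hom.m (0 : X ⟶ Y) = 0 := rfl
@[simp] theorem zero_g (X Y : Tri M) : Hom.g (0 : X ⟶ Y) = 0 := rfl
@[simp] theorem smul_f {X Y : Tri M} (c : K) (a : X ⟶ Y) : (c • a).f = c • a.f := rfl
@[simp] theorem smul_m {X Y : Tri M} (c : K) (a : X ⟶ Y) : (c • a).m = c • a.m := rfl
@[simp] theorem smul_g {X Y : Tri M} (c : K) (a : X ⟶ Y) : (c • a).g = c • a.g := rfl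

instance : Preadditive (Tri M) where
  add_comp _ _ _ a b c := by ext <;> simp; abel
  comp_add _ _ _ a b c := by ext <;> simp; abel

instance : Linear K (Tri M) where
  smul_comp _ _ _ c a b := by ext <;> simp
  comp_smul _ _ _ a c b := by ext <;> simp

/-- The diagonal projections of `Λ`. -/
def fstFunctor (M : Bimod K T U) : Tri M ⥤ T where
  obj X := X.fst
  map a := a.f

/-- The diagonal projections of `Λ`. -/
def sndFunctor (M : Bimod K T U) : Tri M ⥤ U where
  obj X := X.snd
  map a := a.g

instance : (fstFunctor M).Additive where
instance : (sndFunctor M).Additive where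

theorem isZero_iff (X : Tri M) : IsZero X ↔ IsZero X.fst ∧ IsZero X.snd := by
  rw [IsZero.iff_id_eq_zero, IsZero.iff_id_eq_zero, IsZero.iff_id_eq_zero]
  constructor
  · intro h
    exact ⟨congrArg Hom.f h, congrArg Hom.g h⟩
  · rintro ⟨h₁, h₂⟩
    ext
    · exact h₁
    · rfl
    · exact h₂

variable [HasFiniteBiproducts T] [HasFiniteBiproducts U]

instance : HasBinaryBiproducts (Tri M) where
  has_binary_biproduct X Y := hasBinaryBiproduct_of_total
    { pt := ⟨X.fst ⊞ Y.fst, X.snd ⊞ Y.snd⟩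
      fst := ⟨biprod.fst, 0, biprod.fst⟩
      snd := ⟨biprod.snd, 0, biprod.snd⟩
      inl := ⟨biprod.inl, 0, biprod.inl⟩
      inr := ⟨biprod.inr, 0, biprod.inr⟩
      inl_fst := by ext <;> simp
      inl_snd := by ext <;> simp
      inr_fst := by ext <;> simp
      inr_snd := by ext <;> simp }
    (by ext <;> simp)

instance : HasZeroObject (Tri M) :=
  ⟨⟨⟨0, 0⟩, (isZero_iff _).2 ⟨isZero_zero T, isZero_zero U⟩⟩⟩

instance : HasFiniteBiproducts (Tri M) :=
  have : HasFiniteProducts (Tri M) := hasFiniteProducts_of_has_binary_and_terminal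
  HasFiniteBiproducts.of_hasFiniteProducts

/-- `(X ⊕ Y)` has diagonal entries `X.fst ⊕ Y.fst` and `X.snd ⊕ Y.snd`. -/
def biprodFst (X Y : Tri M) : (X ⊞ Y).fst ≅ X.fst ⊞ Y.fst :=
  haveI := preservesBinaryBiproduct_of_preservesBiproduct (fstFunctor M) X Y
  (fstFunctor M).mapBiprod X Y

/-- `(X ⊕ Y)` has diagonal entries `X.fst ⊕ Y.fst` and `X.snd ⊕ Y.snd`. -/
def biprodSnd (X Y : Tri M) : (X ⊞ Y).snd ≅ X.snd ⊞ Y.snd :=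
  haveI := preservesBinaryBiproduct_of_preservesBiproduct (sndFunctor M) X Y
  (sndFunctor M).mapBiprod X Y

/-- The filtration of `Λ`: `Λ_j = (0 0; M U_j)` for `j ≤ n`, and `Λ_{n+j} = (T_j 0; M U)` for
`j ≥ 1`, where `U_n = U`. -/
def filtration (M : Bimod K T U) (𝒯 : AddFiltration T) (𝒰 : AddFiltration U) (n : ℕ)
    (hn : ∀ u, 𝒰.level n u) : AddFiltration (Tri M) where
  level j X := if j ≤ n then IsZero X.fst ∧ 𝒰.level j X.snd else 𝒯.level (j - n) X.fst
  mono j X h := by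
    by_cases h₁ : j + 1 ≤ n
    · rw [if_pos (by omega)] at h
      rw [if_pos h₁]
      exact ⟨h.1, 𝒰.mono j _ h.2⟩
    · rw [if_neg h₁]
      by_cases h₂ : j ≤ n
      · rw [if_pos h₂] at h
        obtain rfl : j = n := by omega
        rw [show j + 1 - j = 0 + 1 by omega]
        exact 𝒯.mono 0 _ ((𝒯.zero_iff _).2 h.1)
      · rw [if_neg h₂] at h
        rw [show j + 1 - n = (j - n) + 1 by omega]
        exact 𝒯.mono _ _ h
  exhaustive X := by
    obtain ⟨j, hj⟩ := 𝒯.exhaustive X.fst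
    refine ⟨n + (j + 1), ?_⟩
    rw [if_neg (by omega), show n + (j + 1) - n = j + 1 by omega]
    exact 𝒯.mono j _ hj
  zero_iff X := by
    rw [if_pos (Nat.zero_le n), isZero_iff, 𝒰.zero_iff]
  of_iso j X Y e h := by
    have e₁ : X.fst ≅ Y.fst := (fstFunctor M).mapIso e
    have e₂ : X.snd ≅ Y.snd := (sndFunctor M).mapIso e
    split_ifs at h ⊢
    · exact ⟨h.1.of_iso e₁.symm, 𝒰.of_iso j _ _ e₂ h.2⟩
    · exact 𝒯.of_iso _ _ _ e₁ h
  biprod j X Y hX hY := by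
    split_ifs at hX hY ⊢
    · refine ⟨?_, 𝒰.of_iso j _ _ (biprodSnd X Y).symm (𝒰.biprod j _ _ hX.2 hY.2)⟩
      have := 𝒯.biprod 0 _ _ ((𝒯.zero_iff _).2 hX.1) ((𝒯.zero_iff _).2 hY.1)
      exact ((𝒯.zero_iff _).1 this).of_iso (biprodFst X Y)
    · exact 𝒯.of_iso _ _ _ (biprodFst X Y).symm (𝒯.biprod _ _ _ hX hY)
  summand j X Y h := by
    split_ifs at h ⊢
    · refine ⟨?_, 𝒰.summand j _ _ (𝒰.of_iso j _ _ (biprodSnd X Y) h.2)⟩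
      have := (𝒯.zero_iff _).2 (h.1.of_iso (biprodFst X Y).symm)
      exact (𝒯.zero_iff _).1 (𝒯.summand 0 _ _ this)
    · exact 𝒯.summand _ _ _ (𝒯.of_iso _ _ _ (biprodFst X Y) h)

/-- The embedding `T ⥤ Λ`, `t ↦ (t 0; M 0)`. -/
def inT (M : Bimod K T U) : T ⥤ Tri M where
  obj t := ⟨t, 0⟩
  map f := ⟨f, 0, 0⟩
  map_id _ := by ext <;> simp
  map_comp _ _ := by ext <;> simp

/-- The embedding `U ⥤ Λ`, `u ↦ (0 0; M u)`. -/
def inU (M : Bimod K T U) : U ⥤ Tri M where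
  obj u := ⟨0, u⟩
  map g := ⟨0, 0, g⟩
  map_id _ := by ext <;> simp
  map_comp _ _ := by ext <;> simp

instance : (inT M).Additive where
  map_add := by
    intro X Y f g
    apply hom_ext
    · rfl
    · exact (add_zero _).symm
    · exact (add_zero _).symm

instance : (inU M).Additive where
  map_add := by
    intro X Y f g
    apply hom_ext
    · exact (add_zero _).symm
    · exact (add_zero _).symm
    · rfl

end Tri

/-- The triples `(F₁, f, F₂)`: a `T`-module `F₁`, a `U`-module `F₂` and a natural transformation
`f : F₁ ⟶ 𝔾 F₂`, where `(𝔾 F₂)(t) = Hom_U(M_t, F₂)`. -/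
structure Triple (M : Bimod K T U) where
  fst : T ⥤ AddCommGrpCat.{v}
  snd : U ⥤ AddCommGrpCat.{v}
  fst_additive : fst.Additive
  snd_additive : snd.Additive
  f : ∀ t : T, fst.obj t →+ (M.col t ⟶ snd)
  naturality : ∀ {t t' : T} (φ : t ⟶ t') (x : fst.obj t),
    f t' ((fst.map φ).hom x) = M.colMap φ ≫ f t x

namespace Triple

variable {M : Bimod K T U}

instance (A : Triple M) : A.fst.Additive := A.fst_additive
instance (A : Triple M) : A.snd.Additive := A.snd_additive

/-- For `x ∈ F₁(t)` and `m ∈ M(u, t)`, the element `f(x)(m)` of `F₂(u)`. -/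
def act (A : Triple M) (t : T) (u : U) (x : A.fst.obj t) (m : M.val t u) : A.snd.obj u :=
  ((A.f t x).app u).hom m

variable (A : Triple M)

theorem act_add_left {t : T} {u : U} (x y : A.fst.obj t) (m : M.val t u) :
    A.act t u (x + y) m = A.act t u x m + A.act t u y m := by
  unfold act; rw [map_add]; rfl

theorem act_add_right {t : T} {u : U} (x : A.fst.obj t) (m m' : M.val t u) :
    A.act t u x (m + m') = A.act t u x m + A.act t u x m' :=
  map_add ((A.f t x).app u).hom m m'

theorem act_zero_left {t : T} {u : U} (m : M.val t u) : A.act t u 0 m = 0 := by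
  unfold act; rw [map_zero]; rfl

theorem act_zero_right {t : T} {u : U} (x : A.fst.obj t) : A.act t u x 0 = 0 :=
  map_zero ((A.f t x).app u).hom

theorem act_left {t : T} {u u' : U} (x : A.fst.obj t) (m : M.val t u) (g : u ⟶ u') :
    A.act t u' x (M.left g m) = (A.snd.map g).hom (A.act t u x m) :=
  congrArg (fun φ => φ.hom m) ((A.f t x).naturality g)

theorem act_right {t t' : T} {u : U} (φ : t ⟶ t') (x : A.fst.obj t) (m : M.val t' u) :
    A.act t' u ((A.fst.map φ).hom x) m = A.act t u x (M.right φ m) := by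
  unfold act; rw [A.naturality]; rfl

/-- The `Λ`-module of a triple: its value at `(t 0; M u)` is `F₁(t) × F₂(u)`, and the morphism
`(φ 0; m g)` acts by `(x, y) ↦ (F₁(φ)(x), f(x)(m) + F₂(g)(y))`. -/
def toModule : Tri M ⥤ AddCommGrpCat.{v} where
  obj X := AddCommGrpCat.of (A.fst.obj X.fst × A.snd.obj X.snd)
  map {X Y} a := AddCommGrpCat.ofHom
    { toFun := fun p => ((A.fst.map a.f).hom p.1,
        A.act X.fst Y.snd p.1 a.m + (A.snd.map a.g).hom p.2)
      map_zero' := by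
        ext
        · simp
        · simp [act_zero_left]
      map_add' := by
        intro p q
        ext
        · simp
        · simp only [Prod.fst_add, Prod.snd_add, act_add_left, map_add]; abel }
  map_id X := by
    ext p
    · change (A.fst.map (𝟙 X.fst)).hom p.1 = p.1
      simp
    · change A.act X.fst X.snd p.1 0 + (A.snd.map (𝟙 X.snd)).hom p.2 = p.2
      simp [act_zero_right]
  map_comp {X Y Z} a b := by
    ext p
    · change (A.fst.map (a.f ≫ b.f)).hom p.1 = (A.fst.map b.f).hom ((A.fst.map a.f).hom p.1)
      simp
    · change A.act X.fst Z.snd p.1 (M.right a.f b.m + M.left b.g a.m) +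
          (A.snd.map (a.g ≫ b.g)).hom p.2 =
        A.act Y.fst Z.snd ((A.fst.map a.f).hom p.1) b.m +
          (A.snd.map b.g).hom (A.act X.fst Y.snd p.1 a.m + (A.snd.map a.g).hom p.2)
      rw [act_right, act_add_right, act_left, map_add, A.snd.map_comp, add_assoc]
      rfl

instance : A.toModule.Additive where
  map_add := by
    intro X Y a b
    ext p
    apply Prod.ext
    · change (A.fst.map (a.f + b.f)).hom p.1 = (A.fst.map a.f).hom p.1 + (A.fst.map b.f).hom p.1
      rw [A.fst.map_add]; rfl
    · change A.act X.fst Y.snd p.1 (a.m + b.m) + (A.snd.map (a.g + b.g)).hom p.2 =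
        (A.act X.fst Y.snd p.1 a.m + (A.snd.map a.g).hom p.2) +
          (A.act X.fst Y.snd p.1 b.m + (A.snd.map b.g).hom p.2)
      rw [act_add_right, A.snd.map_add]
      change _ + ((A.snd.map a.g).hom p.2 + (A.snd.map b.g).hom p.2) = _
      abel

variable [HasFiniteBiproducts T] [HasFiniteBiproducts U]

/-- The triple of a `Λ`-module `F`: `F₁(t) = F(t 0; M 0)`, `F₂(u) = F(0 0; M u)`, and
`f(x)(m) = F(0 0; m 0)(x)`. -/
def ofModule (F : Tri M ⥤ AddCommGrpCat.{v}) [F.Additive] : Triple M where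
  fst := Tri.inT M ⋙ F
  snd := Tri.inU M ⋙ F
  fst_additive := inferInstance
  snd_additive := inferInstance
  f t :=
    { toFun := fun x =>
        { app := fun u => AddCommGrpCat.ofHom
            { toFun := fun m => (F.map (X := (Tri.inT M).obj t) (Y := (Tri.inU M).obj u)
                ⟨0, m, 0⟩).hom x
              map_zero' := by
                change (F.map (0 : (Tri.inT M).obj t ⟶ (Tri.inU M).obj u)).hom x = 0
                rw [F.map_zero]; rfl
              map_add' := fun m m' => by
                have : (⟨0, m + m', 0⟩ : (Tri.inT M).obj t ⟶ (Tri.inU M).obj u) =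
                    (show (Tri.inT M).obj t ⟶ (Tri.inU M).obj u from ⟨0, m, 0⟩) +
                      (show (Tri.inT M).obj t ⟶ (Tri.inU M).obj u from ⟨0, m', 0⟩) := by
                  apply Tri.hom_ext
                  · exact (add_zero _).symm
                  · rfl
                  · exact (add_zero _).symm
                rw [this, F.map_add]; rfl }
          naturality := fun u u' g => by
            ext m
            change (F.map (X := (Tri.inT M).obj t) (Y := (Tri.inU M).obj u')
                ⟨0, M.left g m, 0⟩).hom x = (F.map ((Tri.inU M).map g)).hom
                  ((F.map (X := (Tri.inT M).obj t) (Y := (Tri.inU M).obj u) ⟨0, m, 0⟩).hom x)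
            have : (⟨0, M.left g m, 0⟩ : (Tri.inT M).obj t ⟶ (Tri.inU M).obj u') =
                (show (Tri.inT M).obj t ⟶ (Tri.inU M).obj u from ⟨0, m, 0⟩) ≫
                  (Tri.inU M).map g := by
              apply Tri.hom_ext
              · exact zero_comp.symm
              · simp [Tri.inU]
              · exact zero_comp.symm
            rw [this, F.map_comp]; rfl }
      map_zero' := by ext u m; exact map_zero (F.map _).hom
      map_add' := fun x y => by ext u m; exact map_add (F.map _).hom x y }
  naturality {t t'} φ x := by
    ext u m
    change (F.map (X := (Tri.inT M).obj t') (Y := (Tri.inU M).obj u) ⟨0, m, 0⟩).hom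
        ((F.map ((Tri.inT M).map φ)).hom x) =
      (F.map (X := (Tri.inT M).obj t) (Y := (Tri.inU M).obj u) ⟨0, M.right φ m, 0⟩).hom x
    have : (⟨0, M.right φ m, 0⟩ : (Tri.inT M).obj t ⟶ (Tri.inU M).obj u) =
        (Tri.inT M).map φ ≫
          (show (Tri.inT M).obj t' ⟶ (Tri.inU M).obj u from ⟨0, m, 0⟩) := by
      apply Tri.hom_ext
      · exact comp_zero.symm
      · simp [Tri.inT]
      · exact zero_comp.symm
    rw [this, F.map_comp]; rfl

end Triple

end Triangular

end TriQH

end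

noncomputable section

namespace TriQH

open ZeroObject

attribute [local instance] CategoryTheory.Limits.hasBinaryBiproducts_of_finite_biproducts

/-! ### Isomorphisms of quotients -/

section Modules

variable {C : Type u} [Category.{v} C]

/-! Every object of `Λ` splits as `(t, u) ≅ (t, 0) ⊕ (0, u)`, so an indecomposable object lives in
one diagonal block. A morphism out of `(0, u)` is just its entry in `U`; the standard module of such
an object is therefore a standard `U`-module inflated along `sndFunctor`. A morphism out of `(t, 0)`
has entries `f` and `m`, but in levels above `n` the ideal divided out contains all morphisms with
`f = 0`, since they factor through objects `(0, u')`; the standard module is a standard `T`-module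
inflated along `fstFunctor`. This is the content of `quot_iso_of_isZero_fst` and
`quot_iso_of_isZero_snd`.

Restriction along `inT` and `inU` recovers the two components of a triple. It is computed
objectwise, hence commutes with subquotients and finite direct sums, and it sends a standard module
to a standard module or to zero. So chains restrict to chains, which gives the statement on
`Δ`-filtrations and one half of (iii). Traces restrict as well: a morphism into `(t, 0)` is
determined by its `T`-entry, and a morphism into `(0, u)` from an object with zero first component
by its `U`-entry. Part (i) holds because `Hom((0, u), (t, 0)) = 0` and because every `(0, u)` lies
in `Λ_n`.

For the other half of (iii), the module of a triple is an extension of the inflated first component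
by the inflated second one (`inr`, `fstHom`). `finFiltered_toModule` runs through a chain of the
second component and then through one of the first. Finiteness enters because `f` sends the first
component into the second, which has to be exhausted before the first one starts. -/

theorem nonempty_iso_of_bijective {F F' : C ⥤ AddCommGrpCat.{v}} (η : F ⟶ F')
    (h : ∀ X, Function.Bijective (η.app X).hom) : Nonempty (F ≅ F') := by
  have : ∀ X, IsIso (η.app X) := fun X => (ConcreteCategory.isIso_iff_bijective _).2 (h X)
  have := NatIso.isIso_of_isIso_app η
  exact ⟨asIso η⟩

theorem naturality_apply {F F' : C ⥤ AddCommGrpCat.{v}} (η : F ⟶ F') {X Y : C} (f : X ⟶ Y)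
    (x : F.obj X) : (η.app Y).hom ((F.map f).hom x) = (F'.map f).hom ((η.app X).hom x) :=
  congrArg (fun φ => φ.hom x) (η.naturality f)

theorem map_comp_apply (F : C ⥤ AddCommGrpCat.{v}) {X Y Z : C} (f : X ⟶ Y) (g : Y ⟶ Z)
    (x : F.obj X) : (F.map (f ≫ g)).hom x = (F.map g).hom ((F.map f).hom x) :=
  congrArg (fun φ => φ.hom x) (F.map_comp f g)

theorem iso_hom_inv_apply {F F' : C ⥤ AddCommGrpCat.{v}} (e : F ≅ F') {X : C} (x : F.obj X) :
    (e.inv.app X).hom ((e.hom.app X).hom x) = x :=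
  congrArg (fun φ => φ.hom x) (e.hom_inv_id_app X)

theorem iso_inv_hom_apply {F F' : C ⥤ AddCommGrpCat.{v}} (e : F ≅ F') {X : C} (x : F'.obj X) :
    (e.hom.app X).hom ((e.inv.app X).hom x) = x :=
  congrArg (fun φ => φ.hom x) (e.inv_hom_id_app X)

theorem isZero_of_eq_zero {F : C ⥤ AddCommGrpCat.{v}} (h : ∀ X (x : F.obj X), x = 0) :
    IsZero F := by
  rw [IsZero.iff_id_eq_zero]
  ext X x
  exact h X x

theorem map_eq_zero_of_isZero [Preadditive C] (F : C ⥤ AddCommGrpCat.{v}) [F.Additive] {X : C}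
    (hX : IsZero X)
    (x : F.obj X) : x = 0 := by
  have : (F.map (𝟙 X)).hom x = 0 := by
    rw [hX.eq_of_src (𝟙 X) 0, F.map_zero]; rfl
  simpa using this

namespace Submod

variable {F F' : C ⥤ AddCommGrpCat.{v}}

/-- The morphism of quotients induced by a morphism of modules. -/
def quotMap (η : F ⟶ F') (N : Submod F) (N' : Submod F')
    (h : ∀ X (x : F.obj X), x ∈ N.carrier X → (η.app X).hom x ∈ N'.carrier X) :
    N.quot ⟶ N'.quot where
  app X := AddCommGrpCat.ofHom
    (QuotientAddGroup.map (N.carrier X) (N'.carrier X) (η.app X).hom (fun x hx => h X x hx))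
  naturality X Y f := by
    ext q
    obtain ⟨x, rfl⟩ := QuotientAddGroup.mk_surjective q
    exact congrArg QuotientAddGroup.mk (naturality_apply η f x)

/-- The map `η` need be neither injective nor surjective: the kernel condition and surjectivity
modulo `N'` suffice. This allows `η` to be a projection onto one matrix entry. -/
theorem quot_iso (η : F ⟶ F') (N : Submod F) (N' : Submod F')
    (h : ∀ X (x : F.obj X), x ∈ N.carrier X ↔ (η.app X).hom x ∈ N'.carrier X)
    (hs : ∀ X (y : F'.obj X), ∃ x, y - (η.app X).hom x ∈ N'.carrier X) :
    Nonempty (N.quot ≅ N'.quot) := by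
  refine nonempty_iso_of_bijective (quotMap η N N' fun X x => (h X x).1) fun X => ⟨?_, ?_⟩
  · refine (injective_iff_map_eq_zero _).2 fun q hq => ?_
    obtain ⟨x, rfl⟩ := QuotientAddGroup.mk_surjective q
    exact (QuotientAddGroup.eq_zero_iff x).2 ((h X x).2 ((QuotientAddGroup.eq_zero_iff _).1 hq))
  · intro q
    obtain ⟨y, rfl⟩ := QuotientAddGroup.mk_surjective q
    obtain ⟨x, hx⟩ := hs X y
    refine ⟨QuotientAddGroup.mk x, ?_⟩
    change (QuotientAddGroup.mk ((η.app X).hom x) : F'.obj X ⧸ N'.carrier X) = _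
    refine (QuotientAddGroup.eq.2 ?_)
    rwa [neg_add_eq_sub]

/-- Apply `quot_iso` to the restriction of `η` to `N`. It serves for isomorphisms, and also for the
inclusion and the projection of the two components of a triple. -/
theorem subquot_iso (η : F ⟶ F') (L N : Submod F) (L' N' : Submod F')
    (hN : ∀ X (x : F.obj X), x ∈ N.carrier X → (η.app X).hom x ∈ N'.carrier X)
    (hL : ∀ X (x : F.obj X), x ∈ N.carrier X →
      (x ∈ L.carrier X ↔ (η.app X).hom x ∈ L'.carrier X))
    (hs : ∀ X (y : F'.obj X), y ∈ N'.carrier X →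
      ∃ x ∈ N.carrier X, y - (η.app X).hom x ∈ L'.carrier X) :
    Nonempty (subquot L N ≅ subquot L' N') := by
  let θ : N.toFunctor ⟶ N'.toFunctor :=
    { app := fun X => AddCommGrpCat.ofHom
        (((η.app X).hom.comp (N.carrier X).subtype).codRestrict (N'.carrier X)
          fun x => hN X x.1 x.2)
      naturality := fun X Y f => by
        ext x
        exact Subtype.ext (naturality_apply η f x.1) }
  refine quot_iso θ _ _ (fun X x => hL X x.1 x.2) fun X y => ?_
  obtain ⟨x, hx, h⟩ := hs X y.1 y.2
  exact ⟨⟨x, hx⟩, h⟩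

/-- The image of a submodule under an isomorphism. -/
def mapIso (e : F ≅ F') (N : Submod F) : Submod F' where
  carrier X := (N.carrier X).comap (e.inv.app X).hom
  map_mem f x hx := by
    change (e.inv.app _).hom _ ∈ N.carrier _
    rw [naturality_apply]
    exact N.map_mem f _ hx

theorem subquot_mapIso (e : F ≅ F') (L N : Submod F) :
    Nonempty (subquot L N ≅ subquot (L.mapIso e) (N.mapIso e)) := by
  refine subquot_iso e.hom L N _ _ (fun X x hx => ?_) (fun X x _ => ?_) fun X y hy => ?_
  · change (e.inv.app X).hom _ ∈ N.carrier X
    rwa [iso_hom_inv_apply]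
  · change _ ↔ (e.inv.app X).hom _ ∈ L.carrier X
    rw [iso_hom_inv_apply]
  · refine ⟨(e.inv.app X).hom y, hy, ?_⟩
    rw [iso_inv_hom_apply, sub_self]
    exact zero_mem _

/-- The restriction of a submodule along a functor. -/
def precomp {D : Type u₁} [Category.{v} D] (G : D ⥤ C) (N : Submod F) :
    Submod (G ⋙ F) where
  carrier X := N.carrier (G.obj X)
  map_mem f x hx := N.map_mem (G.map f) x hx

/-- Restriction along a functor commutes with subquotients. -/
def subquotPrecomp {D : Type u₁} [Category.{v} D] (G : D ⥤ C) (L N : Submod F) :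
    G ⋙ subquot L N ≅ subquot (L.precomp G) (N.precomp G) :=
  Iso.refl _

end Submod

/-! ### Finite direct sums and filtrations -/

theorem FinSum.of_iso {𝒳 : (C ⥤ AddCommGrpCat.{v}) → Prop} {F F' : C ⥤ AddCommGrpCat.{v}}
    (h : FinSum 𝒳 F) (e : F ≅ F') : FinSum 𝒳 F' := by
  obtain ⟨m, S, hS, ⟨i⟩⟩ := h
  exact ⟨m, S, hS, ⟨e.symm ≪≫ i⟩⟩

theorem FinSum.of_isZero {𝒳 : (C ⥤ AddCommGrpCat.{v}) → Prop} {F : C ⥤ AddCommGrpCat.{v}}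
    (h : IsZero F) : FinSum 𝒳 F := by
  refine ⟨0, Fin.elim0, fun i => i.elim0, ⟨h.iso ?_⟩⟩
  rw [IsZero.iff_id_eq_zero]
  exact biproduct.hom_ext _ _ fun i => i.elim0

/-- Restriction to a diagonal block kills some standard summands; this discards them. -/
theorem nonempty_biproduct_iso_subtype {ι : Type} [Finite ι] (S : ι → C ⥤ AddCommGrpCat.{v})
    (p : Set ι) (h : ∀ i, i ∉ p → IsZero (S i)) :
    Nonempty (⨁ S ≅ ⨁ fun i : p => S i) := by
  classical
  refine ⟨⟨biproduct.lift fun i : p => biproduct.π S i, biproduct.desc fun i : p => biproduct.ι S i,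
    ?_, ?_⟩⟩
  · refine biproduct.hom_ext' _ _ fun i => ?_
    by_cases hi : i ∈ p
    · have : biproduct.ι S i ≫ biproduct.lift (fun i : p => biproduct.π S i) =
          biproduct.ι (fun i : p => S i) ⟨i, hi⟩ := by
        refine biproduct.hom_ext _ _ fun k => ?_
        rw [Category.assoc, biproduct.lift_π, biproduct.ι_π, biproduct.ι_π]
        by_cases hk : i = k
        · subst hk; simp
        · rw [dif_neg hk, dif_neg fun h' => hk (congrArg Subtype.val h')]
      rw [reassoc_of% this]; simp
    · exact (h i hi).eq_of_src _ _
  · refine biproduct.hom_ext' _ _ fun i => biproduct.hom_ext _ _ fun k => ?_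
    simp only [biproduct.ι_desc_assoc, Category.assoc, biproduct.lift_π, Category.comp_id,
      biproduct.ι_π]
    by_cases hk : i = k
    · subst hk; simp
    · rw [dif_neg hk, dif_neg fun h' => hk (Subtype.ext h')]

instance {D : Type u₁} [Category.{v} D] (G : D ⥤ C) :
    ((Functor.whiskeringLeft D C AddCommGrpCat.{v}).obj G).Additive where
  map_add := rfl

/-- Precomposition with `G` is an additive functor between module categories, so it preserves finite
direct sums; the summands that become zero are then dropped. -/
theorem FinSum.precomp {D : Type u₁} [Category.{v} D] (G : D ⥤ C)
    {𝒳 : (C ⥤ AddCommGrpCat.{v}) → Prop} {𝒴 : (D ⥤ AddCommGrpCat.{v}) → Prop}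
    (h : ∀ S, 𝒳 S → 𝒴 (G ⋙ S) ∨ IsZero (G ⋙ S)) {F : C ⥤ AddCommGrpCat.{v}}
    (hF : FinSum 𝒳 F) : FinSum 𝒴 (G ⋙ F) := by
  obtain ⟨m, S, hS, ⟨i⟩⟩ := hF
  let W := (Functor.whiskeringLeft D C AddCommGrpCat.{v}).obj G
  let p : Set (Fin m) := {k | 𝒴 (G ⋙ S k)}
  obtain ⟨e⟩ := nonempty_biproduct_iso_subtype (fun k => G ⋙ S k) p
    fun k hk => (h _ (hS k)).resolve_left hk
  -- The surviving summands are renumbered, since `FinSum` asks for an index set `Fin l`.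
  obtain ⟨l, ⟨ε⟩⟩ := Finite.exists_equiv_fin p
  refine ⟨l, fun k => G ⋙ S (ε.symm k), fun k => (ε.symm k).2, ⟨W.mapIso i ≪≫ W.mapBiproduct S ≪≫
    e ≪≫ (biproduct.whiskerEquiv ε.symm fun _ => Iso.refl _).symm⟩⟩

theorem IsChain.mapIso {𝒳 : (C ⥤ AddCommGrpCat.{v}) → Prop} {F F' : C ⥤ AddCommGrpCat.{v}}
    {c : ℕ → Submod F} (hc : IsChain 𝒳 c) (e : F ≅ F') :
    IsChain 𝒳 fun j => (c j).mapIso e where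
  mono j X x hx := hc.mono j X hx
  zero X := by
    refine (AddSubgroup.eq_bot_iff_forall _).2 fun x hx => ?_
    change (e.inv.app X).hom x ∈ (c 0).carrier X at hx
    rw [hc.zero, AddSubgroup.mem_bot] at hx
    rw [← iso_inv_hom_apply e x, hx, map_zero]
  step j := (hc.step j).of_iso (Submod.subquot_mapIso e _ _).some

theorem Filtered.of_iso {𝒳 : (C ⥤ AddCommGrpCat.{v}) → Prop} {F F' : C ⥤ AddCommGrpCat.{v}}
    (h : Filtered 𝒳 F) (e : F ≅ F') : Filtered 𝒳 F' := by
  obtain ⟨c, hc, hx⟩ := h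
  exact ⟨_, hc.mapIso e, fun X x => hx X _⟩

theorem FinFiltered.of_iso {𝒳 : (C ⥤ AddCommGrpCat.{v}) → Prop} {F F' : C ⥤ AddCommGrpCat.{v}}
    (h : FinFiltered 𝒳 F) (e : F ≅ F') : FinFiltered 𝒳 F' := by
  obtain ⟨c, hc, m, hm⟩ := h
  refine ⟨_, hc.mapIso e, m, fun X => ?_⟩
  change ((c m).carrier X).comap _ = ⊤
  rw [hm, AddSubgroup.comap_top]

section Precomp

variable {D : Type u₁} [Category.{v} D] (G : D ⥤ C)
  {𝒳 : (C ⥤ AddCommGrpCat.{v}) → Prop} {𝒴 : (D ⥤ AddCommGrpCat.{v}) → Prop}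
  {F : C ⥤ AddCommGrpCat.{v}}

theorem IsChain.precomp (h : ∀ S, 𝒳 S → 𝒴 (G ⋙ S) ∨ IsZero (G ⋙ S))
    {c : ℕ → Submod F} (hc : IsChain 𝒳 c) :
    IsChain 𝒴 fun j => (c j).precomp G where
  mono j X := hc.mono j (G.obj X)
  zero X := hc.zero (G.obj X)
  step j := ((hc.step j).precomp G h).of_iso (Submod.subquotPrecomp G _ _)

theorem Filtered.precomp (h : ∀ S, 𝒳 S → 𝒴 (G ⋙ S) ∨ IsZero (G ⋙ S))
    (hF : Filtered 𝒳 F) : Filtered 𝒴 (G ⋙ F) := by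
  obtain ⟨c, hc, hx⟩ := hF
  exact ⟨_, hc.precomp G h, fun X x => hx (G.obj X) x⟩

theorem FinFiltered.precomp (h : ∀ S, 𝒳 S → 𝒴 (G ⋙ S) ∨ IsZero (G ⋙ S))
    (hF : FinFiltered 𝒳 F) : FinFiltered 𝒴 (G ⋙ F) := by
  obtain ⟨c, hc, m, hm⟩ := hF
  exact ⟨_, hc.precomp G h, m, fun X => hm (G.obj X)⟩

end Precomp

/-! ### Traces -/

variable [Preadditive C]

/-- By Yoneda a morphism `rep E ⟶ F` is determined by the image of `𝟙 E`, so the trace is generated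
by the elements `F(f)(x)` with `x ∈ F(E)`. -/
theorem trace_le {P : ObjectProperty C} {F : C ⥤ AddCommGrpCat.{v}} {X : C}
    {N : AddSubgroup (F.obj X)}
    (h : ∀ (E : C), P E → ∀ (f : E ⟶ X) (x : F.obj E), (F.map f).hom x ∈ N) :
    (trace P F).carrier X ≤ N := by
  refine iSup_le fun E => iSup_le fun hE => iSup_le fun η => ?_
  rintro _ ⟨g, rfl⟩
  have : (η.app X).hom g = (F.map g).hom ((η.app E).hom (𝟙 E)) := by
    refine Eq.trans ?_ (naturality_apply η (X := E) (Y := X) g (𝟙 E))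
    exact congrArg (η.app X).hom (Category.id_comp (X := E) (Y := X) g).symm
  rw [this]
  exact h E hE g _

/-- The morphism `C(E, -) ⟶ F` that corresponds to an element of `F(E)`. -/
def repHom (F : C ⥤ AddCommGrpCat.{v}) [F.Additive] {E : C} (x : F.obj E) : rep E ⟶ F where
  app Y := AddCommGrpCat.ofHom
    { toFun := fun g => (F.map g).hom x
      map_zero' := by rw [F.map_zero]; rfl
      map_add' := fun g g' => by rw [F.map_add]; rfl }
  naturality Y Z f := by
    ext g
    exact map_comp_apply F (X := E) (Y := Y) g f x

theorem map_mem_trace {P : ObjectProperty C} (F : C ⥤ AddCommGrpCat.{v}) [F.Additive] {E X : C}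
    (hE : P E) (f : E ⟶ X) (x : F.obj E) : (F.map f).hom x ∈ (trace P F).carrier X :=
  AddSubgroup.mem_iSup_of_mem E (AddSubgroup.mem_iSup_of_mem hE
    (AddSubgroup.mem_iSup_of_mem (repHom F x) ⟨f, rfl⟩))

theorem mem_trace {P : ObjectProperty C} (F : C ⥤ AddCommGrpCat.{v}) [F.Additive] {X : C}
    (hX : P X) (x : F.obj X) : x ∈ (trace P F).carrier X := by
  simpa using map_mem_trace F hX (𝟙 X) x

theorem app_mem_trace {P : ObjectProperty C} {F F' : C ⥤ AddCommGrpCat.{v}} [F'.Additive]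
    (η : F ⟶ F') {X : C} {x : F.obj X} (hx : x ∈ (trace P F).carrier X) :
    (η.app X).hom x ∈ (trace P F').carrier X := by
  have : (trace P F).carrier X ≤ ((trace P F').carrier X).comap (η.app X).hom :=
    trace_le fun E hE f y => by
      change (η.app X).hom _ ∈ (trace P F').carrier X
      rw [naturality_apply]
      exact map_mem_trace F' hE f _
  exact this hx

theorem app_mem_trace_iff {P : ObjectProperty C} {F F' : C ⥤ AddCommGrpCat.{v}} [F.Additive]
    [F'.Additive] (e : F ≅ F') {X : C} (x : F.obj X) :
    (e.hom.app X).hom x ∈ (trace P F').carrier X ↔ x ∈ (trace P F).carrier X := by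
  refine ⟨fun h => ?_, app_mem_trace e.hom⟩
  rw [← iso_hom_inv_apply e x]
  exact app_mem_trace e.inv h

theorem TraceFiltered.of_iso {K : Type w} [Field K] [HasFiniteBiproducts C] [Linear K C]
    {𝒞 : AddFiltration C} {F F' : C ⥤ AddCommGrpCat.{v}} [F.Additive] [F'.Additive]
    (h : TraceFiltered K 𝒞 F) (e : F ≅ F') : TraceFiltered K 𝒞 F' := fun j => by
  refine (h j).of_iso (Submod.subquot_iso e.hom _ _ _ _ (fun X x hx => app_mem_trace e.hom hx)
    (fun X x _ => (app_mem_trace_iff e x).symm) fun X y hy => ?_).some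
  refine ⟨(e.inv.app X).hom y, app_mem_trace e.inv hy, ?_⟩
  rw [iso_inv_hom_apply, sub_self]
  exact zero_mem _

theorem AddFiltration.level_mono [HasFiniteBiproducts C] (𝒞 : AddFiltration C) {i j : ℕ}
    (hij : i ≤ j) {X : C} (h : 𝒞.level i X) : 𝒞.level j X :=
  Nat.le_induction h (fun k _ hk => 𝒞.mono k X hk) j hij

theorem StandardAt.of_iso {K : Type w} [Field K] [HasFiniteBiproducts C] [Linear K C]
    {𝒞 : AddFiltration C} {j : ℕ} {S S' : C ⥤ AddCommGrpCat.{v}} (h : StandardAt K 𝒞 j S)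
    (e : S ≅ S') : StandardAt K 𝒞 j S' := by
  obtain ⟨E, h₁, h₂, h₃, ⟨i⟩⟩ := h
  exact ⟨E, h₁, h₂, h₃, ⟨e.symm ≪≫ i⟩⟩

/-- A quotient of `C(E, X) = 0` vanishes. Arguing through the representable avoids asking that `S`
be additive. -/
theorem StandardAt.eq_zero {K : Type w} [Field K] [HasFiniteBiproducts C] [Linear K C]
    {𝒞 : AddFiltration C} {j : ℕ} {S : C ⥤ AddCommGrpCat.{v}} (h : StandardAt K 𝒞 j S) {X : C}
    (hX : IsZero X) (x : S.obj X) : x = 0 := by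
  obtain ⟨E, -, -, -, ⟨i⟩⟩ := h
  rw [← iso_hom_inv_apply i x]
  obtain ⟨g, hg⟩ := QuotientAddGroup.mk_surjective ((i.hom.app X).hom x)
  have hg0 : g = 0 := hX.eq_of_tgt (Y := E) g 0
  rw [← hg, hg0]
  exact map_zero (i.inv.app X).hom

end Modules

/-! ### Standard modules over a triangular matrix category -/

section Triangular

variable {K : Type w} [Field K]
  {T : Type u₁} [Category.{v} T] [Preadditive T] [Linear K T]
  {U : Type u₂} [Category.{v} U] [Preadditive U] [Linear K U]

namespace Tri

variable {M : Bimod K T U}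

/-! ### Block decomposition of objects and morphisms of `Λ` -/

theorem val_eq_zero_of_isZero_left {t : T} {u : U} (ht : IsZero t) (m : M.val t u) : m = 0 := by
  have := Bimod.right_id m
  rw [ht.eq_of_src (𝟙 t) 0, Bimod.right_zero] at this
  exact this.symm

theorem val_eq_zero_of_isZero_right {t : T} {u : U} (hu : IsZero u) (m : M.val t u) : m = 0 := by
  have := Bimod.left_id m
  rw [hu.eq_of_src (𝟙 u) 0, Bimod.left_zero] at this
  exact this.symm

theorem isZero_inT_obj [HasFiniteBiproducts U] (t : T) : IsZero ((inT M).obj t) ↔ IsZero t :=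
  (isZero_iff _).trans (and_iff_left (isZero_zero U))

theorem isZero_inU_obj [HasFiniteBiproducts T] (u : U) : IsZero ((inU M).obj u) ↔ IsZero u :=
  (isZero_iff _).trans (and_iff_right (isZero_zero T))

theorem hom_ext_inT [HasFiniteBiproducts U] {X : Tri M} {t : T}
    {a b : X ⟶ (inT M).obj t} (h : a.f = b.f) : a = b :=
  hom_ext h ((val_eq_zero_of_isZero_right (isZero_zero U) _).trans
    (val_eq_zero_of_isZero_right (isZero_zero U) _).symm) ((isZero_zero U).eq_of_tgt _ _)

theorem hom_ext_of_isZero {X Y : Tri M} (hX : IsZero X.fst) {a b : X ⟶ Y} (h : a.g = b.g) :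
    a = b :=
  hom_ext (hX.eq_of_src _ _) ((val_eq_zero_of_isZero_left hX _).trans
    (val_eq_zero_of_isZero_left hX _).symm) h

section

variable [HasFiniteBiproducts U]

/-- The projection `(t 0; M u) ⟶ (t 0; M 0)`. -/
def projT (X : Tri M) : X ⟶ (inT M).obj X.fst := ⟨𝟙 X.fst, 0, 0⟩

/-- The inclusion `(t 0; M 0) ⟶ (t 0; M u)`. -/
def inclT (X : Tri M) : (inT M).obj X.fst ⟶ X := ⟨𝟙 X.fst, 0, 0⟩

theorem inclT_projT (X : Tri M) : inclT X ≫ projT X = 𝟙 _ :=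
  hom_ext_inT (Category.comp_id (𝟙 X.fst))

theorem comp_projT {X Y : Tri M} (a : X ⟶ Y) : a ≫ projT Y = projT X ≫ (inT M).map a.f :=
  hom_ext_inT ((Category.comp_id a.f).trans (Category.id_comp a.f).symm)

theorem eq_projT_comp {X : Tri M} {t : T} (a : X ⟶ (inT M).obj t) :
    a = projT X ≫ (inT M).map (X := X.fst) (Y := t) a.f :=
  hom_ext_inT (Category.id_comp (X := X.fst) (Y := t) a.f).symm

end

section

variable [HasFiniteBiproducts T]

/-- The projection `(t 0; M u) ⟶ (0 0; M u)`. -/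
def projU (X : Tri M) : X ⟶ (inU M).obj X.snd := ⟨0, 0, 𝟙 X.snd⟩

/-- The inclusion `(0 0; M u) ⟶ (t 0; M u)`. -/
def inclU (X : Tri M) : (inU M).obj X.snd ⟶ X := ⟨0, 0, 𝟙 X.snd⟩

theorem inclU_projU (X : Tri M) : inclU X ≫ projU X = 𝟙 _ :=
  hom_ext_of_isZero (isZero_zero T) (Category.comp_id (𝟙 X.snd))

theorem eq_projU_comp {X : Tri M} (hX : IsZero X.fst) {u : U} (a : X ⟶ (inU M).obj u) :
    a = projU X ≫ (inU M).map (X := X.snd) (Y := u) a.g :=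
  hom_ext_of_isZero hX (Category.id_comp (X := X.snd) (Y := u) a.g).symm

end

variable [HasFiniteBiproducts T] [HasFiniteBiproducts U]

theorem inclU_projT (X : Tri M) : inclU X ≫ projT X = 0 :=
  hom_ext_of_isZero (isZero_zero T) comp_zero

theorem inclT_projU (X : Tri M) : inclT X ≫ projU X = 0 := by
  apply hom_ext
  · exact comp_zero
  · change M.right (𝟙 X.fst) (0 : M.val X.fst X.snd) + M.left (𝟙 X.snd) (0 : M.val X.fst X.snd) = 0
    simp
  · exact zero_comp

theorem projT_inclT_add_projU_inclU (X : Tri M) :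
    projT X ≫ inclT X + projU X ≫ inclU X = 𝟙 X := by
  apply hom_ext
  · change 𝟙 X.fst ≫ 𝟙 X.fst + (0 : X.fst ⟶ 0) ≫ (0 : 0 ⟶ X.fst) = 𝟙 X.fst
    simp
  · change (M.right (𝟙 X.fst) (0 : M.val X.fst X.snd) + M.left (0 : 0 ⟶ X.snd) (0 : M.val X.fst 0)) +
      (M.right (0 : X.fst ⟶ 0) (0 : M.val 0 X.snd) + M.left (𝟙 X.snd) (0 : M.val X.fst X.snd)) = 0
    simp
  · change (0 : X.snd ⟶ 0) ≫ (0 : 0 ⟶ X.snd) + 𝟙 X.snd ≫ 𝟙 X.snd = 𝟙 X.snd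
    simp

/-- This is the second row `(m g)` of the matrix `a`; it yields the formula for the action on the
second component of a triple. -/
theorem comp_projU {X Y : Tri M} (a : X ⟶ Y) :
    a ≫ projU Y = projT X ≫ (show (inT M).obj X.fst ⟶ (inU M).obj Y.snd from ⟨0, a.m, 0⟩) +
      projU X ≫ (inU M).map a.g := by
  apply hom_ext
  · change a.f ≫ (0 : Y.fst ⟶ 0) = 𝟙 X.fst ≫ (0 : X.fst ⟶ 0) + (0 : X.fst ⟶ 0) ≫ (0 : (0 : T) ⟶ 0)
    simp
  · change M.right a.f (0 : M.val Y.fst Y.snd) + M.left (𝟙 Y.snd) a.m =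
      (M.right (𝟙 X.fst) a.m + M.left (0 : 0 ⟶ Y.snd) (0 : M.val X.fst 0)) +
        (M.right (0 : X.fst ⟶ 0) (0 : M.val 0 Y.snd) + M.left a.g (0 : M.val X.fst X.snd))
    simp
  · change a.g ≫ 𝟙 Y.snd = (0 : X.snd ⟶ 0) ≫ (0 : 0 ⟶ Y.snd) + 𝟙 X.snd ≫ a.g
    simp

/-- Every object is the direct sum of its two components. -/
def isoBiprod (X : Tri M) : X ≅ (inT M).obj X.fst ⊞ (inU M).obj X.snd where
  hom := biprod.lift (projT X) (projU X)
  inv := biprod.desc (inclT X) (inclU X)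
  hom_inv_id := by rw [biprod.lift_desc, projT_inclT_add_projU_inclU]
  inv_hom_id := by
    refine biprod.hom_ext' _ _ (biprod.hom_ext _ _ ?_ ?_) (biprod.hom_ext _ _ ?_ ?_) <;>
      simp [inclT_projT, inclU_projU, inclT_projU, inclU_projT]

/-- An object with zero second component lies in the image of `inT`. -/
def isoInT (X : Tri M) (h : IsZero X.snd) : X ≅ (inT M).obj X.fst where
  hom := projT X
  inv := inclT X
  hom_inv_id := by
    have : projU X = 0 := by
      apply hom_ext
      · rfl
      · rfl
      · exact h.eq_of_src _ _
    rw [← projT_inclT_add_projU_inclU, this, zero_comp, add_zero]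
  inv_hom_id := inclT_projT X

/-- An object with zero first component lies in the image of `inU`. -/
def isoInU (X : Tri M) (h : IsZero X.fst) : X ≅ (inU M).obj X.snd where
  hom := projU X
  inv := inclU X
  hom_inv_id := hom_ext_of_isZero h (Category.comp_id (𝟙 X.snd))
  inv_hom_id := inclU_projU X

/-- By `isoBiprod`, one of the two blocks must vanish. This is what separates the standard modules
of `Λ` into two families. -/
theorem isZero_fst_or_snd {X : Tri M} (h : Indecomposable X) : IsZero X.fst ∨ IsZero X.snd :=
  (h.2 _ _ (isoBiprod X)).imp (isZero_inT_obj _).1 (isZero_inU_obj _).1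

theorem isZero_left_of_biprod {C : Type*} [Category C] [Preadditive C]
    [HasBinaryBiproducts C] {X Y Z : C} (e : X ≅ Y ⊞ Z) (h : IsZero X) : IsZero Y := by
  rw [IsZero.iff_id_eq_zero, ← biprod.inl_fst (X := Y) (Y := Z),
    (h.of_iso e.symm).eq_of_tgt biprod.inl 0, zero_comp]

theorem isZero_right_of_biprod {C : Type*} [Category C] [Preadditive C]
    [HasBinaryBiproducts C] {X Y Z : C} (e : X ≅ Y ⊞ Z) (h : IsZero X) : IsZero Z := by
  rw [IsZero.iff_id_eq_zero, ← biprod.inr_snd (X := Y) (Y := Z),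
    (h.of_iso e.symm).eq_of_tgt biprod.inr 0, zero_comp]

theorem indecomposable_of_iso {C : Type*} [Category C] [Preadditive C]
    [HasBinaryBiproducts C] {X Y : C} (e : X ≅ Y) (h : Indecomposable X) : Indecomposable Y :=
  ⟨fun hY => h.1 (hY.of_iso e), fun A B i => h.2 A B (e ≪≫ i)⟩

/-- A decomposition of `t` is carried over by the additive functor `inT`. Conversely, in a
decomposition of `(t, 0)` the second components are summands of zero, so only the first ones matter.
-/
theorem indecomposable_inT_obj (t : T) : Indecomposable ((inT M).obj t) ↔ Indecomposable t := by
  refine ⟨fun h => ⟨fun ht => h.1 ((isZero_inT_obj t).2 ht), fun Y Z e => ?_⟩,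
    fun h => ⟨fun ht => h.1 ((isZero_inT_obj t).1 ht), fun Y Z e => ?_⟩⟩
  · have := preservesBinaryBiproduct_of_preservesBiproduct (inT M) Y Z
    exact (h.2 _ _ ((inT M).mapIso e ≪≫ (inT M).mapBiprod Y Z)).imp
      (isZero_inT_obj Y).1 (isZero_inT_obj Z).1
  · let e₁ : t ≅ Y.fst ⊞ Z.fst := (fstFunctor M).mapIso e ≪≫ biprodFst Y Z
    let e₂ : (0 : U) ≅ Y.snd ⊞ Z.snd := (sndFunctor M).mapIso e ≪≫ biprodSnd Y Z
    have h₀ := isZero_zero U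
    exact (h.2 _ _ e₁).imp (fun h' => (isZero_iff _).2 ⟨h', isZero_left_of_biprod e₂ h₀⟩)
      fun h' => (isZero_iff _).2 ⟨h', isZero_right_of_biprod e₂ h₀⟩

theorem indecomposable_inU_obj (u : U) : Indecomposable ((inU M).obj u) ↔ Indecomposable u := by
  refine ⟨fun h => ⟨fun ht => h.1 ((isZero_inU_obj u).2 ht), fun Y Z e => ?_⟩,
    fun h => ⟨fun ht => h.1 ((isZero_inU_obj u).1 ht), fun Y Z e => ?_⟩⟩
  · have := preservesBinaryBiproduct_of_preservesBiproduct (inU M) Y Z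
    exact (h.2 _ _ ((inU M).mapIso e ≪≫ (inU M).mapBiprod Y Z)).imp
      (isZero_inU_obj Y).1 (isZero_inU_obj Z).1
  · let e₁ : u ≅ Y.snd ⊞ Z.snd := (sndFunctor M).mapIso e ≪≫ biprodSnd Y Z
    let e₂ : (0 : T) ≅ Y.fst ⊞ Z.fst := (fstFunctor M).mapIso e ≪≫ biprodFst Y Z
    have h₀ := isZero_zero T
    exact (h.2 _ _ e₁).imp (fun h' => (isZero_iff _).2 ⟨isZero_left_of_biprod e₂ h₀, h'⟩)
      fun h' => (isZero_iff _).2 ⟨isZero_right_of_biprod e₂ h₀, h'⟩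

/-! ### Levels of the filtration of `Λ` and its standard modules -/

variable {𝒯 : AddFiltration T} {𝒰 : AddFiltration U} {n : ℕ} {hn : ∀ u, 𝒰.level n u}

theorem level_of_le {j : ℕ} (hj : j ≤ n) (X : Tri M) :
    (filtration M 𝒯 𝒰 n hn).level j X ↔ IsZero X.fst ∧ 𝒰.level j X.snd := by
  change (if j ≤ n then _ else _) ↔ _
  rw [if_pos hj]

theorem level_of_lt {j : ℕ} (hj : n < j) (X : Tri M) :
    (filtration M 𝒯 𝒰 n hn).level j X ↔ 𝒯.level (j - n) X.fst := by
  change (if j ≤ n then _ else _) ↔ _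
  rw [if_neg (by omega)]

/-- The boundary case `j = n` fits the same formula, because the level `0` of `𝒯` consists of the
zero objects. -/
theorem level_inT_obj {j : ℕ} (hj : n ≤ j) (t : T) :
    (filtration M 𝒯 𝒰 n hn).level j ((inT M).obj t) ↔ 𝒯.level (j - n) t := by
  rcases hj.eq_or_lt with rfl | hj
  · rw [level_of_le le_rfl, Nat.sub_self, 𝒯.zero_iff]
    exact and_iff_left (hn _)
  · exact level_of_lt hj _

theorem level_inU_obj {j : ℕ} (hj : j ≤ n) (u : U) :
    (filtration M 𝒯 𝒰 n hn).level j ((inU M).obj u) ↔ 𝒰.level j u := by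
  rw [level_of_le hj]
  exact and_iff_right (isZero_zero T)

/-- A morphism out of `E` is a pair `(f, m)`. The entry `m` imposes no condition for membership in
the ideal, so the quotient sees `f` alone, modulo the ideal of `𝒯`. -/
theorem quot_iso_of_isZero_snd {E : Tri M} (hE : IsZero E.snd) {j : ℕ} (hj : n ≤ j) :
    Nonempty ((((filtration M 𝒯 𝒰 n hn).ideal K j).sub E).quot ≅
      fstFunctor M ⋙ ((𝒯.ideal K (j - n)).sub E.fst).quot) := by
  let η : rep E ⟶ fstFunctor M ⋙ rep E.fst :=
    { app := fun X => AddCommGrpCat.ofHom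
        { toFun := fun a => Hom.f a
          map_zero' := rfl
          map_add' := fun _ _ => rfl } }
  refine Submod.quot_iso η _ (((𝒯.ideal K (j - n)).sub E.fst).precomp (fstFunctor M)) ?_ ?_
  · rintro X (a : E ⟶ X)
    constructor
    · rintro ⟨Y, b, c, hY, rfl⟩
      refine ⟨Y.fst, b.f, c.f, ?_, rfl⟩
      rcases hj.eq_or_lt with rfl | hj
      · rw [Nat.sub_self, 𝒯.zero_iff]
        exact ((level_of_le le_rfl _).1 hY).1
      · exact (level_of_lt hj _).1 hY
    · rintro ⟨t, b, c, ht, (h : b ≫ c = a.f)⟩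
      -- The intermediate object takes over all of `X.snd`, which levels `j ≥ n` allow; the first
      -- factor carries `a.m` and the second passes it on through `𝟙`.
      refine ⟨⟨t, X.snd⟩, ⟨b, a.m, 0⟩, ⟨c, 0, 𝟙 _⟩, ?_, ?_⟩
      · rcases hj.eq_or_lt with rfl | hj
        · rw [Nat.sub_self, 𝒯.zero_iff] at ht
          exact (level_of_le le_rfl _).2 ⟨ht, hn _⟩
        · exact (level_of_lt hj _).2 ht
      · ext
        · exact h
        · simp
        · exact hE.eq_of_src _ _
  · rintro X (y : E.fst ⟶ X.fst)
    refine ⟨(⟨y, 0, 0⟩ : E ⟶ X), ?_⟩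
    change y - y ∈ _
    rw [sub_self]
    exact zero_mem _

/-- Out of an object with zero first component only the entry `g` remains, and a factorisation of
`g` through `u` is one through `(0, u)`. -/
theorem quot_iso_of_isZero_fst {E : Tri M} (hE : IsZero E.fst) {j : ℕ} (hj : j ≤ n) :
    Nonempty ((((filtration M 𝒯 𝒰 n hn).ideal K j).sub E).quot ≅
      sndFunctor M ⋙ ((𝒰.ideal K j).sub E.snd).quot) := by
  let η : rep E ⟶ sndFunctor M ⋙ rep E.snd :=
    { app := fun X => AddCommGrpCat.ofHom
        { toFun := fun a => Hom.g a
          map_zero' := rfl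
          map_add' := fun _ _ => rfl } }
  refine Submod.quot_iso η _ (((𝒰.ideal K j).sub E.snd).precomp (sndFunctor M)) ?_ ?_
  · rintro X (a : E ⟶ X)
    constructor
    · rintro ⟨Y, b, c, hY, rfl⟩
      exact ⟨Y.snd, b.g, c.g, ((level_of_le hj _).1 hY).2, rfl⟩
    · rintro ⟨u, b, c, hu, (h : b ≫ c = a.g)⟩
      refine ⟨⟨0, u⟩, ⟨0, 0, b⟩, ⟨0, 0, c⟩, (level_inU_obj hj u).2 hu, ?_⟩
      ext
      · exact hE.eq_of_src _ _
      · exact (val_eq_zero_of_isZero_left hE _).trans (val_eq_zero_of_isZero_left hE _).symm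
      · exact h
  · rintro X (y : E.snd ⟶ X.snd)
    refine ⟨(⟨0, 0, y⟩ : E ⟶ X), ?_⟩
    change y - y ∈ _
    rw [sub_self]
    exact zero_mem _

/-- Index `j` in `StandardAt` means level `j + 1`, so level `j + 1` of `𝒯` matches level `n + j + 1`
of `Λ`. -/
theorem standardAt_fstFunctor_comp {j : ℕ} {S : T ⥤ AddCommGrpCat.{v}} (h : StandardAt K 𝒯 j S) :
    StandardAt K (filtration M 𝒯 𝒰 n hn) (n + j) (fstFunctor M ⋙ S) := by
  obtain ⟨t, h₁, h₂, h₃, ⟨i⟩⟩ := h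
  obtain ⟨e⟩ := quot_iso_of_isZero_snd (𝒯 := 𝒯) (hn := hn) (E := (inT M).obj t) (isZero_zero U)
    (Nat.le_add_right n j)
  refine ⟨(inT M).obj t, (indecomposable_inT_obj t).2 h₁, (level_inT_obj (by omega) t).2 ?_,
    fun h => h₃ ?_, ⟨?_⟩⟩
  · rwa [show n + j + 1 - n = j + 1 by omega]
  · rwa [level_inT_obj (by omega), Nat.add_sub_cancel_left] at h
  · rw [Nat.add_sub_cancel_left] at e
    exact Functor.isoWhiskerLeft (fstFunctor M) i ≪≫ e.symm

theorem lt_of_standardAt (hn : ∀ u, 𝒰.level n u) {j : ℕ} {S : U ⥤ AddCommGrpCat.{v}}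
    (h : StandardAt K 𝒰 j S) : j < n := by
  obtain ⟨E, -, -, h, -⟩ := h
  by_contra hj
  exact h (𝒰.level_mono (not_lt.1 hj) (hn E))

theorem standardAt_sndFunctor_comp {j : ℕ} {S : U ⥤ AddCommGrpCat.{v}} (h : StandardAt K 𝒰 j S) :
    StandardAt K (filtration M 𝒯 𝒰 n hn) j (sndFunctor M ⋙ S) := by
  have hj := lt_of_standardAt hn h
  obtain ⟨u, h₁, h₂, h₃, ⟨i⟩⟩ := h
  obtain ⟨e⟩ := quot_iso_of_isZero_fst (𝒯 := 𝒯) (hn := hn) (E := (inU M).obj u) (isZero_zero T)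
    hj.le
  exact ⟨(inU M).obj u, (indecomposable_inU_obj u).2 h₁, (level_inU_obj hj u).2 h₂,
    fun h => h₃ ((level_inU_obj hj.le u).1 h),
    ⟨Functor.isoWhiskerLeft (sndFunctor M) i ≪≫ e.symm⟩⟩

theorem exists_standardAt_fst {j : ℕ} (hj : n ≤ j) {S : Tri M ⥤ AddCommGrpCat.{v}}
    (h : StandardAt K (filtration M 𝒯 𝒰 n hn) j S) :
    ∃ S' : T ⥤ AddCommGrpCat.{v}, StandardAt K 𝒯 (j - n) S' ∧ Nonempty (S ≅ fstFunctor M ⋙ S') := by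
  obtain ⟨E, h₁, h₂, h₃, ⟨i⟩⟩ := h
  have h₃' : ¬ 𝒯.level (j - n) E.fst := fun h => h₃ <| by
    rcases hj.eq_or_lt with rfl | hj
    · rw [Nat.sub_self, 𝒯.zero_iff] at h
      exact (level_of_le le_rfl _).2 ⟨h, hn _⟩
    · exact (level_of_lt hj _).2 h
  -- If `E.fst` were zero it would lie in every level of `𝒯`, so `E` would already lie in level `j`.
  have hE : IsZero E.snd := (isZero_fst_or_snd h₁).resolve_left fun h =>
    h₃' (𝒯.level_mono (Nat.zero_le _) ((𝒯.zero_iff _).2 h))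
  obtain ⟨e⟩ := quot_iso_of_isZero_snd (𝒯 := 𝒯) (hn := hn) hE hj
  refine ⟨_, ⟨E.fst, (indecomposable_inT_obj _).1 (indecomposable_of_iso (isoInT E hE) h₁), ?_, h₃',
    ⟨Iso.refl _⟩⟩, ⟨i ≪≫ e⟩⟩
  rw [level_of_lt (by omega)] at h₂
  rwa [show j - n + 1 = j + 1 - n by omega]

theorem exists_standardAt_snd {j : ℕ} (hj : j < n) {S : Tri M ⥤ AddCommGrpCat.{v}}
    (h : StandardAt K (filtration M 𝒯 𝒰 n hn) j S) :
    ∃ S' : U ⥤ AddCommGrpCat.{v}, StandardAt K 𝒰 j S' ∧ Nonempty (S ≅ sndFunctor M ⋙ S') := by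
  obtain ⟨E, h₁, h₂, h₃, ⟨i⟩⟩ := h
  rw [level_of_le hj] at h₂
  obtain ⟨e⟩ := quot_iso_of_isZero_fst (𝒯 := 𝒯) (hn := hn) h₂.1 hj.le
  exact ⟨_, ⟨E.snd, (indecomposable_inU_obj _).1 (indecomposable_of_iso (isoInU E h₂.1) h₁), h₂.2,
    fun h => h₃ ((level_of_le hj.le _).2 ⟨h₂.1, h⟩), ⟨Iso.refl _⟩⟩, ⟨i ≪≫ e⟩⟩

/-! ### Restriction to the two diagonal blocks -/

theorem standardAt_inT_comp {j : ℕ} (hj : n ≤ j) {S : Tri M ⥤ AddCommGrpCat.{v}}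
    (h : StandardAt K (filtration M 𝒯 𝒰 n hn) j S) : StandardAt K 𝒯 (j - n) (inT M ⋙ S) := by
  obtain ⟨S', hS', ⟨e⟩⟩ := exists_standardAt_fst hj h
  -- The composite of `inT` and `fstFunctor` is definitionally the identity of `T`.
  exact hS'.of_iso (show S' ≅ inT M ⋙ S from
    (Functor.isoWhiskerLeft (inT M) e : inT M ⋙ S ≅ inT M ⋙ fstFunctor M ⋙ S').symm)

theorem standardAt_inU_comp {j : ℕ} (hj : j < n) {S : Tri M ⥤ AddCommGrpCat.{v}}
    (h : StandardAt K (filtration M 𝒯 𝒰 n hn) j S) : StandardAt K 𝒰 j (inU M ⋙ S) := by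
  obtain ⟨S', hS', ⟨e⟩⟩ := exists_standardAt_snd hj h
  exact hS'.of_iso (show S' ≅ inU M ⋙ S from
    (Functor.isoWhiskerLeft (inU M) e : inU M ⋙ S ≅ inU M ⋙ sndFunctor M ⋙ S').symm)

/-- Such a module is inflated along `sndFunctor`, which is zero on every object `(t, 0)`. -/
theorem isZero_inT_comp {j : ℕ} (hj : j < n) {S : Tri M ⥤ AddCommGrpCat.{v}}
    (h : StandardAt K (filtration M 𝒯 𝒰 n hn) j S) : IsZero (inT M ⋙ S) := by
  obtain ⟨S', hS', ⟨e⟩⟩ := exists_standardAt_snd hj h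
  exact IsZero.of_iso (isZero_of_eq_zero fun X x => hS'.eq_zero (isZero_zero U) x)
    (Functor.isoWhiskerLeft (inT M) e)

theorem isZero_inU_comp {j : ℕ} (hj : n ≤ j) {S : Tri M ⥤ AddCommGrpCat.{v}}
    (h : StandardAt K (filtration M 𝒯 𝒰 n hn) j S) : IsZero (inU M ⋙ S) := by
  obtain ⟨S', hS', ⟨e⟩⟩ := exists_standardAt_fst hj h
  exact IsZero.of_iso (isZero_of_eq_zero fun X x => hS'.eq_zero (isZero_zero T) x)
    (Functor.isoWhiskerLeft (inU M) e)

theorem standard_inT_comp (S : Tri M ⥤ AddCommGrpCat.{v})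
    (h : Standard K (filtration M 𝒯 𝒰 n hn) S) :
    Standard K 𝒯 (inT M ⋙ S) ∨ IsZero (inT M ⋙ S) := by
  obtain ⟨j, h⟩ := h
  rcases le_or_gt n j with hj | hj
  · exact Or.inl ⟨_, standardAt_inT_comp hj h⟩
  · exact Or.inr (isZero_inT_comp hj h)

theorem standard_inU_comp (S : Tri M ⥤ AddCommGrpCat.{v})
    (h : Standard K (filtration M 𝒯 𝒰 n hn) S) :
    Standard K 𝒰 (inU M ⋙ S) ∨ IsZero (inU M ⋙ S) := by
  obtain ⟨j, h⟩ := h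
  rcases le_or_gt n j with hj | hj
  · exact Or.inr (isZero_inU_comp hj h)
  · exact Or.inl ⟨_, standardAt_inU_comp hj h⟩

/-! ### Trace filtrations on the two diagonal blocks -/

variable (F : Tri M ⥤ AddCommGrpCat.{v}) [F.Additive]

theorem traceAt_inT_obj_eq_bot {j : ℕ} (hj : j ≤ n) (t : T) :
    (traceAt (filtration M 𝒯 𝒰 n hn) F j).carrier ((inT M).obj t) = ⊥ := by
  refine le_bot_iff.1 (trace_le fun E hE f x => ?_)
  have : f = 0 := by
    ext
    · exact ((level_of_le hj _).1 hE).1.eq_of_src _ _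
    · exact val_eq_zero_of_isZero_right (isZero_zero U) _
    · exact (isZero_zero U).eq_of_tgt _ _
  rw [this, F.map_zero]
  exact zero_mem _

theorem traceAt_inU_obj_eq_top {j : ℕ} (hj : n ≤ j) (u : U) :
    (traceAt (filtration M 𝒯 𝒰 n hn) F j).carrier ((inU M).obj u) = ⊤ :=
  top_unique fun x _ => mem_trace F
    ((filtration M 𝒯 𝒰 n hn).level_mono hj ((level_inU_obj le_rfl u).2 (hn u))) x

/-- For `j ≤ n` the generating objects have zero first component, so each morphism to `(0, u)`
factors through `projU` followed by a morphism of `U`. -/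
theorem traceAt_inU_obj {j : ℕ} (hj : j ≤ n) (u : U) :
    (traceAt (filtration M 𝒯 𝒰 n hn) F j).carrier ((inU M).obj u) =
      (traceAt 𝒰 (inU M ⋙ F) j).carrier u := by
  apply le_antisymm
  · refine trace_le fun E hE f x => ?_
    obtain ⟨h₁, h₂⟩ := (level_of_le hj _).1 hE
    have : (F.map f).hom x = ((inU M ⋙ F).map (X := E.snd) (Y := u) f.g).hom
        ((F.map (projU E)).hom x) :=
      (congrArg (fun a => (F.map a).hom x) (eq_projU_comp h₁ f)).trans (map_comp_apply _ _ _ _)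
    rw [this]
    exact map_mem_trace (inU M ⋙ F) h₂ f.g _
  · exact trace_le fun E hE f x => map_mem_trace F ((level_inU_obj hj E).2 hE) ((inU M).map f) x

/-- Every morphism to `(t, 0)` factors through `projT`, so the arbitrary second component of a
generating object contributes nothing new. -/
theorem traceAt_inT_obj (j : ℕ) (t : T) :
    (traceAt (filtration M 𝒯 𝒰 n hn) F (n + j)).carrier ((inT M).obj t) =
      (traceAt 𝒯 (inT M ⋙ F) j).carrier t := by
  apply le_antisymm
  · refine trace_le fun E hE f x => ?_
    have h : 𝒯.level j E.fst := by
      rcases Nat.eq_zero_or_pos j with rfl | hj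
      · exact (𝒯.zero_iff _).2 ((level_of_le le_rfl _).1 hE).1
      · have := (level_of_lt (by omega) _).1 hE
        rwa [Nat.add_sub_cancel_left] at this
    have : (F.map f).hom x = ((inT M ⋙ F).map (X := E.fst) (Y := t) f.f).hom
        ((F.map (projT E)).hom x) :=
      (congrArg (fun a => (F.map a).hom x) (eq_projT_comp f)).trans (map_comp_apply _ _ _ _)
    rw [this]
    exact map_mem_trace (inT M ⋙ F) h f.f _
  · refine trace_le fun E hE f x => map_mem_trace F ?_ ((inT M).map f) x
    rwa [level_inT_obj (by omega), Nat.add_sub_cancel_left]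

variable {F}

theorem traceFiltered_inT_comp (h : TraceFiltered K (filtration M 𝒯 𝒰 n hn) F) :
    TraceFiltered K 𝒯 (inT M ⋙ F) := fun j => by
  have := (h (n + j)).precomp (inT M) (𝒴 := StandardAt K 𝒯 j) fun S hS => Or.inl <| by
    simpa using standardAt_inT_comp (by omega) hS
  refine this.of_iso (Submod.subquotPrecomp (inT M) _ _ ≪≫ eqToIso ?_)
  congr 1
  · exact Submod.ext (funext fun t => traceAt_inT_obj F j t)
  · exact Submod.ext (funext fun t => traceAt_inT_obj F (j + 1) t)

theorem traceFiltered_inU_comp (h : TraceFiltered K (filtration M 𝒯 𝒰 n hn) F) :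
    TraceFiltered K 𝒰 (inU M ⋙ F) := fun j => by
  rcases lt_or_ge j n with hj | hj
  · have := (h j).precomp (inU M) (𝒴 := StandardAt K 𝒰 j) fun S hS =>
      Or.inl (standardAt_inU_comp hj hS)
    refine this.of_iso (Submod.subquotPrecomp (inU M) _ _ ≪≫ eqToIso ?_)
    congr 1
    · exact Submod.ext (funext fun u => traceAt_inU_obj F hj.le u)
    · exact Submod.ext (funext fun u => traceAt_inU_obj F hj u)
  -- From `n` on the filtration of `U` is stationary: the trace is already the whole module and the
  -- layers vanish.
  · refine FinSum.of_isZero (isZero_of_eq_zero fun u q => ?_)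
    obtain ⟨x, rfl⟩ := QuotientAddGroup.mk_surjective q
    exact (QuotientAddGroup.eq_zero_iff x).2
      (mem_trace (inU M ⋙ F) (𝒰.level_mono hj (hn u)) x.1)

end Tri

/-! ### Modules of triples as extensions of their components -/

namespace Triple

variable {M : Bimod K T U} (A : Triple M)

/-- The inclusion of the second component of a triple into its module. -/
def inr : Tri.sndFunctor M ⋙ A.snd ⟶ A.toModule where
  app X := AddCommGrpCat.ofHom (AddMonoidHom.inr (A.fst.obj X.fst) (A.snd.obj X.snd))
  naturality X Y a := by
    ext y
    apply Prod.ext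
    · exact (map_zero (A.fst.map a.f).hom).symm
    · change (A.snd.map a.g).hom y = A.act X.fst Y.snd 0 a.m + (A.snd.map a.g).hom y
      rw [act_zero_left, zero_add]

/-- The projection of the module of a triple onto its first component. -/
def fstHom : A.toModule ⟶ Tri.fstFunctor M ⋙ A.fst where
  app X := AddCommGrpCat.ofHom (AddMonoidHom.fst (A.fst.obj X.fst) (A.snd.obj X.snd))

theorem nonempty_inT_comp_toModule_iso [HasFiniteBiproducts U] :
    Nonempty (Tri.inT M ⋙ A.toModule ≅ A.fst) := by
  refine nonempty_iso_of_bijective (Functor.whiskerLeft (Tri.inT M) A.fstHom) fun t => ⟨?_, ?_⟩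
  · rintro ⟨x, y⟩ ⟨x', y'⟩ h
    refine Prod.ext h ?_
    exact (map_eq_zero_of_isZero A.snd (isZero_zero U) y).trans
      (map_eq_zero_of_isZero A.snd (isZero_zero U) y').symm
  · exact fun x => ⟨(x, 0), rfl⟩

theorem nonempty_iso_inU_comp_toModule [HasFiniteBiproducts T] :
    Nonempty (A.snd ≅ Tri.inU M ⋙ A.toModule) := by
  refine nonempty_iso_of_bijective (F := A.snd) (Functor.whiskerLeft (Tri.inU M) A.inr)
    fun u => ⟨?_, ?_⟩
  · exact fun y y' h => congrArg Prod.snd h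
  · rintro ⟨x, y⟩
    refine ⟨y, Prod.ext ?_ rfl⟩
    exact (map_eq_zero_of_isZero A.fst (isZero_zero T) x).symm

variable [HasFiniteBiproducts T] [HasFiniteBiproducts U]

/-- The projections and inclusions of the two blocks give `F(t, u) ≅ F(t, 0) ⊕ F(0, u)`. Naturality
is the row description of a matrix in `comp_projT` and `comp_projU`. -/
theorem nonempty_iso_toModule_ofModule (F : Tri M ⥤ AddCommGrpCat.{v}) [F.Additive] :
    Nonempty (F ≅ (ofModule F).toModule) := by
  have comp_apply {X Y Z : Tri M} (a : X ⟶ Y) (b : Y ⟶ Z) (x : F.obj X) :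
      (F.map b).hom ((F.map a).hom x) = (F.map (a ≫ b)).hom x := (map_comp_apply F a b x).symm
  have id_apply {X : Tri M} (x : F.obj X) : (F.map (𝟙 X)).hom x = x := by simp
  have zero_apply {X Y : Tri M} (x : F.obj X) : (F.map (0 : X ⟶ Y)).hom x = 0 := by
    rw [F.map_zero]; rfl
  have add_apply {X Y : Tri M} (a b : X ⟶ Y) (x : F.obj X) :
      (F.map (a + b)).hom x = (F.map a).hom x + (F.map b).hom x := by
    rw [F.map_add]; rfl
  let η : F ⟶ (ofModule F).toModule :=
    { app := fun X => AddCommGrpCat.ofHom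
        (AddMonoidHom.prod (F.map (Tri.projT X)).hom (F.map (Tri.projU X)).hom)
      naturality := fun X Y a => by
        ext x
        apply Prod.ext
        · change (F.map (Tri.projT Y)).hom ((F.map a).hom x) =
            (F.map ((Tri.inT M).map a.f)).hom ((F.map (Tri.projT X)).hom x)
          rw [comp_apply, comp_apply, Tri.comp_projT]
        · change (F.map (Tri.projU Y)).hom ((F.map a).hom x) =
            (F.map (show (Tri.inT M).obj X.fst ⟶ (Tri.inU M).obj Y.snd from
              ⟨0, a.m, 0⟩)).hom ((F.map (Tri.projT X)).hom x) +
            (F.map ((Tri.inU M).map a.g)).hom ((F.map (Tri.projU X)).hom x)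
          rw [comp_apply, comp_apply, comp_apply, ← add_apply, Tri.comp_projU] }
  refine nonempty_iso_of_bijective η fun X => ⟨?_, ?_⟩
  · refine (injective_iff_map_eq_zero _).2 fun x hx => ?_
    have h₁ : (F.map (Tri.projT X)).hom x = 0 := congrArg Prod.fst hx
    have h₂ : (F.map (Tri.projU X)).hom x = 0 := congrArg Prod.snd hx
    rw [← id_apply x, ← Tri.projT_inclT_add_projU_inclU, add_apply, ← comp_apply, ← comp_apply,
      h₁, h₂, map_zero, map_zero, add_zero]
  · rintro ⟨(y : F.obj ((Tri.inT M).obj X.fst)), (z : F.obj ((Tri.inU M).obj X.snd))⟩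
    refine ⟨(F.map (Tri.inclT X)).hom y + (F.map (Tri.inclU X)).hom z, Prod.ext ?_ ?_⟩
    · change (F.map (Tri.projT X)).hom
        ((F.map (Tri.inclT X)).hom y + (F.map (Tri.inclU X)).hom z) = y
      rw [map_add, comp_apply, comp_apply, Tri.inclT_projT, Tri.inclU_projT, id_apply, zero_apply,
        add_zero]
    · change (F.map (Tri.projU X)).hom
        ((F.map (Tri.inclT X)).hom y + (F.map (Tri.inclU X)).hom z) = z
      rw [map_add, comp_apply, comp_apply, Tri.inclT_projU, Tri.inclU_projU, id_apply, zero_apply,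
        zero_add]

/-! ### Gluing finite filtrations of the two components -/

variable {𝒯 : AddFiltration T} {𝒰 : AddFiltration U} {n : ℕ} {hn : ∀ u, 𝒰.level n u} {A}

/-- The layers below `l` are those of `d`, inflated along `sndFunctor`; the later ones are those of
`c`, inflated along `fstFunctor`. Inflation preserves standard modules. -/
theorem finFiltered_toModule (h₁ : FinFiltered (Standard K 𝒯) A.fst)
    (h₂ : FinFiltered (Standard K 𝒰) A.snd) :
    FinFiltered (Standard K (Tri.filtration M 𝒯 𝒰 n hn)) A.toModule := by
  obtain ⟨c, hc, m, hm⟩ := h₁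
  obtain ⟨d, hd, l, hl⟩ := h₂
  have hdl (j : ℕ) (hj : l ≤ j) (u : U) : (d j).carrier u = ⊤ :=
    Nat.le_induction (hl u) (fun k _ hk => top_unique (hk ▸ hd.mono k u)) j hj
  have hc0 (j : ℕ) (hj : j ≤ l) (t : T) : (c (j - l)).carrier t = ⊥ := by
    rw [Nat.sub_eq_zero_of_le hj, hc.zero]
  -- Truncated subtraction keeps the first component at `c 0 = 0` for `j ≤ l`, while `d j` is
  -- everything for `j ≥ l`.
  let N (j : ℕ) : Submod A.toModule :=
    { carrier := fun X => ((c (j - l)).carrier X.fst).prod ((d j).carrier X.snd)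
      map_mem := by
        rintro X Y a ⟨x, y⟩ ⟨hx, hy⟩
        refine ⟨(c (j - l)).map_mem a.f x hx, ?_⟩
        change A.act X.fst Y.snd x a.m + (A.snd.map a.g).hom y ∈ (d j).carrier Y.snd
        -- The term `f(x)(m)` need not lie in `d j`: before `l` it vanishes because `x = 0`, and
        -- afterwards `d j` is the whole second component.
        rcases le_total j l with hj | hj
        · have hx0 : x = 0 := by
            change x ∈ (c (j - l)).carrier X.fst at hx
            rwa [hc0 j hj, AddSubgroup.mem_bot] at hx
          rw [hx0, act_zero_left, zero_add]
          exact (d j).map_mem a.g y hy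
        · rw [hdl j hj]
          trivial }
  refine ⟨N, ⟨fun j X => AddSubgroup.prod_mono ?_ (hd.mono j _), fun X => ?_, fun j => ?_⟩,
    l + m, fun X => ?_⟩
  · rcases le_or_gt l j with hj | hj
    · rw [show j + 1 - l = j - l + 1 by omega]
      exact hc.mono _ _
    · rw [hc0 j hj.le]
      exact bot_le
  · change AddSubgroup.prod _ _ = ⊥
    rw [hc0 0 (Nat.zero_le _), hd.zero, AddSubgroup.bot_prod_bot]
  · rcases lt_or_ge j l with hj | hj
    · refine ((hd.step j).precomp (Tri.sndFunctor M)
        fun S ⟨k, hS⟩ => Or.inl ⟨k, Tri.standardAt_sndFunctor_comp hS⟩).of_iso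
        (Submod.subquotPrecomp _ _ _ ≪≫
          (Submod.subquot_iso A.inr _ _ (N j) (N (j + 1)) ?_ ?_ ?_).some)
      · exact fun X y hy => ⟨zero_mem ((c (j + 1 - l)).carrier X.fst), hy⟩
      · exact fun X y _ => ⟨fun hy => ⟨zero_mem ((c (j - l)).carrier X.fst), hy⟩, And.right⟩
      · rintro X ⟨x, y⟩ ⟨hx, hy⟩
        change x ∈ (c (j + 1 - l)).carrier X.fst at hx
        rw [hc0 _ hj, AddSubgroup.mem_bot] at hx
        subst hx
        refine ⟨y, hy, ?_⟩
        have : (A.inr.app X).hom y = (0, y) := rfl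
        rw [this]
        exact (sub_self (G := A.fst.obj X.fst × A.snd.obj X.snd) (0, y)).symm ▸
          zero_mem ((N j).carrier X)
    -- Both terms now contain the full second component, so the projection `fstHom` identifies the
    -- layer with one of `c`.
    · have := (hc.step (j - l)).precomp (Tri.fstFunctor M)
        (𝒴 := Standard K (Tri.filtration M 𝒯 𝒰 n hn))
        fun S ⟨k, hS⟩ => Or.inl ⟨n + k, Tri.standardAt_fstFunctor_comp hS⟩
      refine this.of_iso
        ((Submod.subquot_iso A.fstHom (N j) (N (j + 1)) _ _ ?_ ?_ ?_).some ≪≫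
          (Submod.subquotPrecomp _ _ _).symm).symm
      · intro X x hx
        rw [← show j + 1 - l = j - l + 1 by omega]
        exact hx.1
      · refine fun X x _ => ⟨fun hx => hx.1, fun hx => ⟨hx, ?_⟩⟩
        rw [hdl j hj]
        trivial
      · intro X x hx
        refine ⟨(x, 0), ⟨?_, zero_mem _⟩, ?_⟩
        · rw [show j + 1 - l = j - l + 1 by omega]
          exact hx
        · change x - x ∈ (c (j - l)).carrier X.fst
          rw [sub_self]
          exact zero_mem _
  · change AddSubgroup.prod _ _ = ⊤
    rw [Nat.add_sub_cancel_left, hm, hdl _ (Nat.le_add_right _ _), AddSubgroup.top_prod_top]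

end Triple

end Triangular

end TriQH

end

/-! ### The three statements for `Λ`-modules -/

theorem mainTheorem2 {K : Type w} [Field K]
    {T : Type u₁} [Category.{v} T] [Preadditive T] [Linear K T] [HasFiniteBiproducts T]
    {U : Type u₂} [Category.{v} U] [Preadditive U] [Linear K U] [HasFiniteBiproducts U]
    (hT : TriQH.HomFinite K T) (hT' : TriQH.KrullSchmidt T)
    (hU : TriQH.HomFinite K U) (hU' : TriQH.KrullSchmidt U)
    (𝒯 : TriQH.AddFiltration T) (h𝒯 : TriQH.QuasiHereditary K 𝒯)
    (𝒰 : TriQH.AddFiltration U) (h𝒰 : TriQH.QuasiHereditary K 𝒰)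
    (n : ℕ) (hn : ∀ X : U, 𝒰.level n X)
    (M : TriQH.Bimod K T U) (hM : ∀ (t : T) (X : U), Module.Finite K (M.val t X))
    (hMΔ : ∀ t : T, TriQH.Filtered (TriQH.Standard K 𝒰) (M.col t))
    (Λ : TriQH.AddFiltration (TriQH.Tri M)) (hΛ : Λ = TriQH.Tri.filtration M 𝒯 𝒰 n hn) :
    (∀ (F : TriQH.Tri M ⥤ AddCommGrpCat.{v}) [F.Additive],
      Nonempty (F ≅ (TriQH.Triple.ofModule F).toModule)) ∧
    ∀ (F : TriQH.Tri M ⥤ AddCommGrpCat.{v}) [F.Additive] (A : TriQH.Triple M),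
      (F ≅ A.toModule) →
      (∀ j, j ≤ n →
        IsZero (TriQH.Triple.ofModule (TriQH.traceAt Λ F j).toFunctor).fst) ∧
      (∀ j, n < j →
        IsIso (Functor.whiskerLeft (TriQH.Tri.inU M) (TriQH.traceAt Λ F j).ι) ∧
        Nonempty ((TriQH.Triple.ofModule (TriQH.traceAt Λ F j).toFunctor).snd ≅ A.snd)) ∧
      (TriQH.Filtered (TriQH.Standard K Λ) F →
        TriQH.Filtered (TriQH.Standard K 𝒯) A.fst ∧
        TriQH.Filtered (TriQH.Standard K 𝒰) A.snd) ∧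
      (TriQH.TraceFiltered K Λ F →
        TriQH.TraceFiltered K 𝒯 A.fst ∧ TriQH.TraceFiltered K 𝒰 A.snd) ∧
      (TriQH.FinFiltered (TriQH.Standard K Λ) F ↔
        TriQH.FinFiltered (TriQH.Standard K 𝒯) A.fst ∧
        TriQH.FinFiltered (TriQH.Standard K 𝒰) A.snd) := by
  subst hΛ
  refine ⟨fun F _ => TriQH.Triple.nonempty_iso_toModule_ofModule F, fun F _ A e => ?_⟩
  obtain ⟨i₁⟩ := A.nonempty_inT_comp_toModule_iso
  obtain ⟨i₂⟩ := A.nonempty_iso_inU_comp_toModule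
  have e₁ : TriQH.Tri.inT M ⋙ F ≅ A.fst := Functor.isoWhiskerLeft (TriQH.Tri.inT M) e ≪≫ i₁
  have e₂ : TriQH.Tri.inU M ⋙ F ≅ A.snd := Functor.isoWhiskerLeft (TriQH.Tri.inU M) e ≪≫ i₂.symm
  refine ⟨fun j hj => ?_, fun j hj => ?_, fun h => ⟨?_, ?_⟩, fun h => ⟨?_, ?_⟩,
    fun h => ⟨?_, ?_⟩, fun h => ?_⟩
  · refine TriQH.isZero_of_eq_zero fun t x => Subtype.ext ?_
    exact (AddSubgroup.eq_bot_iff_forall _).1 (TriQH.Tri.traceAt_inT_obj_eq_bot F hj t) x.1 x.2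
  · have : IsIso (Functor.whiskerLeft (TriQH.Tri.inU M)
        (TriQH.traceAt (TriQH.Tri.filtration M 𝒯 𝒰 n hn) F j).ι) := by
      rw [NatTrans.isIso_iff_isIso_app]
      refine fun u => (ConcreteCategory.isIso_iff_bijective _).2
        ⟨Subtype.val_injective, fun x => ⟨⟨x, ?_⟩, rfl⟩⟩
      rw [TriQH.Tri.traceAt_inU_obj_eq_top F hj.le]
      trivial
    -- The second component of `ofModule` is restriction along `inU` by definition, so the
    -- restricted inclusion composes directly with `e₂`.
    exact ⟨this, ⟨@asIso _ _ _ _ _ this ≪≫ e₂⟩⟩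
  · exact (h.precomp _ TriQH.Tri.standard_inT_comp).of_iso e₁
  · exact (h.precomp _ TriQH.Tri.standard_inU_comp).of_iso e₂
  · exact (TriQH.Tri.traceFiltered_inT_comp h).of_iso e₁
  · exact (TriQH.Tri.traceFiltered_inU_comp h).of_iso e₂
  · exact (h.precomp _ TriQH.Tri.standard_inT_comp).of_iso e₁
  · exact (h.precomp _ TriQH.Tri.standard_inU_comp).of_iso e₂
  · exact (TriQH.Triple.finFiltered_toModule h.1 h.2).of_iso e.symm
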